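/- Let $K\subset\mathbb{R}$ be a subfield, let $n\ge 2$ and $0\le l\le m$ be integers, let $d$ be an even natural number, and let $f_1,\dots,f_m,g\in K[x_1,\dots,x_n]$ have total degree at most $d$. Put $$E=\{x\in\mathbb{R}^n \mid f_1(x)=\dots=f_l(x)=0,\ f_{l+1}(x)\ge 0,\dots,f_m(x)\ge 0\}.$$ Suppose that $g$ attains a minimum value $g_{\min}$ on $E$ and that $E^{\min}=\{x\in E\mid g(x)=g_{\min}\}$ has at least one compact connected component. Let $q_0=n+1$, let $q_1<\dots<q_m$ be the first $m$ primes greater than $n+1$, and put $a_{ij}=\frac{1}{q_i-j}$ for $0\le i\le m$, $0\le j\le n$. Let $T_d$ be the Chebyshev polynomial (of the first kind) of degree $d$, and set $$\tilde g(x)=\sum_{j=1}^n a_{0j}T_d(x_j),\qquad \tilde f_i(x)=a_{i0}+\sum_{j=1}^n a_{ij}\,(T_d(x_j)+1)\quad(1\le i\le m),$$ $$G(t,x)=t\,g(x)+(1-t)\,\tilde g(x),\qquad F_i^{\pm}(t,x)=t\,f_i(x)\pm(1-t)\,\tilde f_i(x).$$ For $S\subset\{1,\dots,m\}$ and $\sigma\in\{+,-\}^S$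 let $$\hat V_{S,\sigma}=\Big\{(t,x,\lambda)\in\mathbb{A}^1_{\mathbb{C}}\times\mathbb{A}^n_{\mathbb{C}}\times\mathbb{P}^{|S|}_{\mathbb{C}}\ \Big|\ F_i^{\sigma_i}(t,x)=0\ \text{for all } i\in S,\ \ \lambda_0\nabla_xG(t,x)=\sum_{i\in S}\lambda_i\nabla_xF_i^{\sigma_i}(t,x)\Big\},$$ and let $V_{S,\sigma}$ be the union of those irreducible components (for the Zariski topology) of $\hat V_{S,\sigma}$ that are not contained in $\{t=t_0\}$ for any $t_0\in\mathbb{C}$. Let $\mathcal{S}$ be the set of pairs $(S,\sigma)$ with $S\subset\{1,\dots,m\}$, $|S|\le n$, $\sigma\in\{+,-\}^S$ and $\sigma_i=+$ for every $i\in S$ with $i>l$. Let $\Pi_x$ denote the projection $(t,x,\lambda)\mapsto x$. Then the set $$\bigcup_{(S,\sigma)\in\mathcal{S}}\Pi_x\big(V_{S,\sigma}\cap\{t=1\}\big)\subset\mathbb{C}^n$$ is finite, and it contains a point of every compact connected component of $E^{\min}$ (where $\mathbb{R}^n\subset\mathbb{C}^n$). -/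

import Mathlib

namespace PolyMin

/-! ### The optimization problem -/

/-- The basic closed semialgebraic set defined by `f i = 0` for the first `l` indices `i` and
`f i ≥ 0` for the remaining ones. -/
def feasibleSet {K : Subfield ℝ} {n m : ℕ} (l : ℕ) (f : Fin m → MvPolynomial (Fin n) K) :
    Set (Fin n → ℝ) :=
  {x | (∀ i : Fin m, i.val < l → MvPolynomial.aeval x (f i) = 0) ∧
    ∀ i : Fin m, l ≤ i.val → 0 ≤ MvPolynomial.aeval x (f i)}

/-- The points of `E` at which `g` takes the value `gmin`. -/
def minimizerSet {K : Subfield ℝ} {n : ℕ} (E : Set (Fin n → ℝ)) (g : MvPolynomial (Fin n) K)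
    (gmin : ℝ) : Set (Fin n → ℝ) :=
  {x ∈ E | MvPolynomial.aeval x g = gmin}

/-- `C` is a connected component of the subset `A`. -/
def IsConnectedComponentOf {X : Type*} [TopologicalSpace X] (C A : Set X) : Prop :=
  ∃ x ∈ A, C = connectedComponentIn A x

/-! ### The Cauchy matrix and the initial polynomials of the deformation -/

/-- `q 0 = n + 1`, and `q 1 < q 2 < ⋯` are the primes greater than `n + 1`, in order. -/
noncomputable def q (n : ℕ) : ℕ → ℕ
  | 0 => n + 1
  | i + 1 => Nat.nth (fun p => p.Prime ∧ n + 1 < p) i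

/-- The entries `a i j = 1 / (q i - j)` of the Cauchy matrix, `0 ≤ i ≤ m` and `0 ≤ j ≤ n`. -/
noncomputable def a (n i j : ℕ) : ℚ := 1 / ((q n i : ℚ) - (j : ℚ))

/-- The Chebyshev polynomial `T_d` in the variable `x j`. -/
noncomputable def chebVar {n : ℕ} (d : ℕ) (j : Fin n) : MvPolynomial (Fin n) ℂ :=
  Polynomial.aeval (MvPolynomial.X j) (Polynomial.Chebyshev.T ℂ (d : ℤ))

/-- `g̃ = ∑_{1 ≤ j ≤ n} a 0 j * T_d(x_j)`; the index `j : Fin n` stands for column `j + 1`. -/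
noncomputable def gTilde (n d : ℕ) : MvPolynomial (Fin n) ℂ :=
  ∑ j : Fin n, MvPolynomial.C ((a n 0 (j.val + 1) : ℚ) : ℂ) * chebVar d j

/-- `f̃_i = a i 0 + ∑_{1 ≤ j ≤ n} a i j * (T_d(x_j) + 1)`; the index `i : Fin m` stands for
row `i + 1`. -/
noncomputable def fTilde (n d : ℕ) {m : ℕ} (i : Fin m) : MvPolynomial (Fin n) ℂ :=
  MvPolynomial.C ((a n (i.val + 1) 0 : ℚ) : ℂ) +
    ∑ j : Fin n, MvPolynomial.C ((a n (i.val + 1) (j.val + 1) : ℚ) : ℂ) * (chebVar d j + 1)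

/-- A polynomial with coefficients in `K ⊆ ℝ`, seen with complex coefficients. -/
noncomputable def toComplex {K : Subfield ℝ} {n : ℕ} (p : MvPolynomial (Fin n) K) :
    MvPolynomial (Fin n) ℂ :=
  MvPolynomial.map (algebraMap K ℂ) p

/-- `G(t, x) = t g(x) + (1 - t) g̃(x)`, as a polynomial in `x` for each `t`. -/
noncomputable def G {K : Subfield ℝ} {n : ℕ} (d : ℕ) (g : MvPolynomial (Fin n) K) (t : ℂ) :
    MvPolynomial (Fin n) ℂ :=
  MvPolynomial.C t * toComplex g + MvPolynomial.C (1 - t) * gTilde n d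

/-- `F_i^±(t, x) = t f_i(x) ± (1 - t) f̃_i(x)`, as a polynomial in `x` for each `t`; the sign is
the unit `ε = ±1` of `ℤ`. -/
noncomputable def F {K : Subfield ℝ} {n m : ℕ} (d : ℕ) (f : Fin m → MvPolynomial (Fin n) K)
    (i : Fin m) (ε : ℤˣ) (t : ℂ) : MvPolynomial (Fin n) ℂ :=
  MvPolynomial.C t * toComplex (f i) +
    MvPolynomial.C (((ε : ℤ) : ℂ) * (1 - t)) * fTilde n d i

/-! ### The space `𝔸 × 𝔸ⁿ × ℙˢ` with its Zariski topology -/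

/-- The set of complex points of `𝔸 × 𝔸ⁿ × ℙ^|ι|`. The homogeneous coordinates of the last factor
are indexed by `Option ι`: `none` for `λ_0` and `some i` for `λ_i`. -/
structure TXL (n : ℕ) (ι : Type) where
  t : ℂ
  x : Fin n → ℂ
  lam : Projectivization ℂ (Option ι → ℂ)

/-- The variables `t` (`Sum.inl none`), `x_j` (`Sum.inl (some j)`), `λ_0` (`Sum.inr none`) and
`λ_i` (`Sum.inr (some i)`). -/
abbrev TXLVar (n : ℕ) (ι : Type) : Type := Option (Fin n) ⊕ Option ι

/-- `p` is homogeneous, of some degree, in the group of variables `λ`. -/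
def IsLamHomogeneous {n : ℕ} {ι : Type} (p : MvPolynomial (TXLVar n ι) ℂ) : Prop :=
  ∃ k : ℕ, MvPolynomial.IsWeightedHomogeneous
    (Sum.elim (fun _ => 0) (fun _ => 1) : TXLVar n ι → ℕ) p k

/-- The zero set of a polynomial that is homogeneous in `λ` (its vanishing does not depend on the
representative of the projective point). -/
def zeroSet {n : ℕ} {ι : Type} (p : MvPolynomial (TXLVar n ι) ℂ) : Set (TXL n ι) :=
  {P | MvPolynomial.eval (Sum.elim (fun o => o.elim P.t P.x) P.lam.rep) p = 0}

/-- The Zariski topology: the closed sets are the common zero sets of families of polynomials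
that are homogeneous in `λ`. -/
instance zariskiTopology (n : ℕ) (ι : Type) : TopologicalSpace (TXL n ι) :=
  TopologicalSpace.generateFrom
    {U | ∃ p : MvPolynomial (TXLVar n ι) ℂ, IsLamHomogeneous p ∧ U = (zeroSet p)ᶜ}

/-- The irreducible components of a subset: its maximal irreducible subsets. -/
def componentsOf {X : Type*} [TopologicalSpace X] (A : Set X) : Set (Set X) :=
  {Z | Maximal (fun Z : Set X => IsIrreducible Z ∧ Z ⊆ A) Z}

/-! ### The varieties of the deformation -/

/-- The variety `V̂_{S,σ}` of all `(t, x, λ)` with `F_i^{σ_i}(t, x) = 0` for `i ∈ S` and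
`λ_0 ∇_x G(t, x) = ∑_{i ∈ S} λ_i ∇_x F_i^{σ_i}(t, x)`. -/
def hatV {K : Subfield ℝ} {n m : ℕ} (d : ℕ) (f : Fin m → MvPolynomial (Fin n) K)
    (g : MvPolynomial (Fin n) K) (S : Finset (Fin m)) (σ : S → ℤˣ) : Set (TXL n S) :=
  {P | (∀ i : S, MvPolynomial.eval P.x (F d f i.val (σ i) P.t) = 0) ∧
    ∀ j : Fin n,
      P.lam.rep none * MvPolynomial.eval P.x (MvPolynomial.pderiv j (G d g P.t)) =
        ∑ i : S, P.lam.rep (some i) *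
          MvPolynomial.eval P.x (MvPolynomial.pderiv j (F d f i.val (σ i) P.t))}

/-- The variety `V_{S,σ}`: the union of the irreducible components of `V̂_{S,σ}` that are not
included in `{t = t₀}` for any `t₀ ∈ ℂ`. -/
def V {K : Subfield ℝ} {n m : ℕ} (d : ℕ) (f : Fin m → MvPolynomial (Fin n) K)
    (g : MvPolynomial (Fin n) K) (S : Finset (Fin m)) (σ : S → ℤˣ) : Set (TXL n S) :=
  ⋃₀ {Z | Z ∈ componentsOf (hatV d f g S σ) ∧ ¬ ∃ t₀ : ℂ, Z ⊆ {P | P.t = t₀}}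

/-- The set `𝒮` of pairs `(S, σ)` with `|S| ≤ n` and `σ_i = +` for the indices `i ∈ S` of
inequalities. -/
def signedSubsets (n m l : ℕ) : Set (Σ S : Finset (Fin m), (S → ℤˣ)) :=
  {p | p.1.card ≤ n ∧ ∀ i : p.1, l ≤ i.val.val → p.2 i = 1}

/-- The union over `(S, σ) ∈ 𝒮` of the sets `Π_x(V_{S,σ} ∩ {t = 1}) ⊆ ℂⁿ`. -/
def sampleSet {K : Subfield ℝ} {n m : ℕ} (l d : ℕ) (f : Fin m → MvPolynomial (Fin n) K)
    (g : MvPolynomial (Fin n) K) : Set (Fin n → ℂ) :=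
  ⋃ p ∈ signedSubsets n m l, TXL.x '' (V d f g p.1 p.2 ∩ {P | P.t = 1})

end PolyMin

/-!
Let `L` be a compact neighbourhood of a compact component `C` of the set of minimizers that meets
this set only in the interior of `L`, and minimize `G(t, ·)` on the part of `L` where the
constraints `F_i^+ ≥ 0` and, for `i ≤ l`, `F_i^- ≤ 0` hold. As `T_d ≥ -1` for even `d`, each `f̃_i`
is positive on `ℝⁿ`. So for `t < 1` the polynomials `F_i^+` and `F_i^-` have no common real zero,
and the gradients of `G` and of the active constraints at a minimizer are linearly dependent;
at most `n` of the constraints suffice for that, which gives a point of some `V̂_{S,σ}`. As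
`t → 1`, these points accumulate, with `λ` on the unit sphere, at a point of `V_{S,σ}` over a
minimizer of `g` in `L`. Since `L` can be chosen arbitrarily close to `C`, finiteness of the set of
all limit points yields one in `C` itself.

For finiteness, the leading forms of `f̃_i` and `∇ g̃`, `∇ f̃_i` are combinations of the `x_j ^ d`
and `x_j ^ (d - 1)` with coefficients in a Cauchy matrix, whose minors are all nonzero. Modulo
`t`, and up to multiplication by the `λ_i`, they therefore express monomials of large degree
through monomials of smaller degree, and Nakayama's lemma gives for each coordinate `x_j` a
nontrivial polynomial relation over `ℂ[t]` on `V̂_{S,σ}`. Such a relation can be divided by a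
power of `t - 1` on the components that do not lie in a fibre of `t`, so `x_j` takes finitely many
values on `V_{S,σ} ∩ {t = 1}`.
-/

namespace PolyMin

open MvPolynomial Topology Filter

section Zariski

variable {n : ℕ} {ι : Type}

/-- The weights for which `IsLamHomogeneous` is weighted homogeneity. -/
def lamWeight (n : ℕ) (ι : Type) : TXLVar n ι → ℕ := Sum.elim (fun _ => 0) (fun _ => 1)

namespace TXL

/-- The affine coordinates `(t, x)` of a point. -/
def base (P : TXL n ι) : Option (Fin n) → ℂ := fun o => o.elim P.t P.x

/-- All the coordinates `(t, x, λ)` of a point, for the chosen representative of `λ`. -/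
noncomputable def coords (P : TXL n ι) : TXLVar n ι → ℂ := Sum.elim P.base P.lam.rep

/-- The point with affine coordinates `(t, x)` and homogeneous coordinates `v`. -/
noncomputable def ofCoords (z : ℂ × (Fin n → ℂ) × {v : Option ι → ℂ // v ≠ 0}) : TXL n ι :=
  ⟨z.1, z.2.1, Projectivization.mk ℂ z.2.2.1 z.2.2.2⟩

theorem exists_lam_rep_ofCoords (z : ℂ × (Fin n → ℂ) × {v : Option ι → ℂ // v ≠ 0}) :
    ∃ c : ℂ, c ≠ 0 ∧ (ofCoords z).lam.rep = c • z.2.2.1 := by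
  obtain ⟨c, hc⟩ := Projectivization.exists_smul_eq_mk_rep ℂ z.2.2.1 z.2.2.2
  exact ⟨c, c.ne_zero, hc.symm⟩

/-- The prime ideal of the polynomials that vanish at the chosen coordinates of a point. It makes
the Zariski topology a coarsening of a topology induced from a prime spectrum. -/
noncomputable def toSpec (P : TXL n ι) : PrimeSpectrum (MvPolynomial (TXLVar n ι) ℂ) :=
  ⟨RingHom.ker (eval P.coords), RingHom.ker_isPrime _⟩

theorem toSpec_preimage_zeroLocus (p : MvPolynomial (TXLVar n ι) ℂ) :
    toSpec ⁻¹' PrimeSpectrum.zeroLocus {p} = zeroSet p := by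
  ext P
  simp only [Set.mem_preimage, PrimeSpectrum.mem_zeroLocus, Set.singleton_subset_iff]
  rfl

end TXL

theorem noetherianSpace_of_le {X : Type*} {τ τ' : TopologicalSpace X} (h : τ ≤ τ')
    (hτ : @TopologicalSpace.NoetherianSpace X τ) : @TopologicalSpace.NoetherianSpace X τ' :=
  @TopologicalSpace.noetherianSpace_of_surjective _ _ τ τ' hτ id (continuous_id_of_le h)
    Function.surjective_id

instance noetherianSpace [Finite ι] : TopologicalSpace.NoetherianSpace (TXL n ι) := by
  let τ : TopologicalSpace (TXL n ι) := .induced TXL.toSpec inferInstance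
  refine noetherianSpace_of_le (τ := τ) (le_generateFrom ?_)
    (@IsInducing.noetherianSpace _ _ _ τ _ _ (@IsInducing.mk _ _ τ _ _ rfl))
  rintro U ⟨p, -, rfl⟩
  exact ⟨(PrimeSpectrum.zeroLocus {p})ᶜ, (PrimeSpectrum.isClosed_zeroLocus _).isOpen_compl,
    by rw [Set.preimage_compl, TXL.toSpec_preimage_zeroLocus]⟩

theorem isClosed_zeroSet {p : MvPolynomial (TXLVar n ι) ℂ} (hp : IsLamHomogeneous p) :
    IsClosed (zeroSet p) :=
  ⟨TopologicalSpace.isOpen_generateFrom_of_mem ⟨p, hp, rfl⟩⟩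

theorem isWeightedHomogeneous_rename_inl (p : MvPolynomial (Option (Fin n)) ℂ) :
    IsWeightedHomogeneous (lamWeight n ι) (rename Sum.inl p) 0 := by
  induction p using MvPolynomial.induction_on with
  | C a => simpa using isWeightedHomogeneous_C _ a
  | add p q hp hq => simpa using hp.add hq
  | mul_X p i hp =>
    simpa [lamWeight] using hp.mul (isWeightedHomogeneous_X ℂ (lamWeight n ι) (Sum.inl i))

theorem isClosed_setOf_eval_base_eq_zero (p : MvPolynomial (Option (Fin n)) ℂ) :
    IsClosed {P : TXL n ι | eval P.base p = 0} := by
  have h : {P : TXL n ι | eval P.base p = 0} = zeroSet (rename Sum.inl p) := by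
    ext P
    simp only [zeroSet, Set.mem_ofPred_eq, eval_rename, Sum.elim_comp_inl]
    rfl
  rw [h]
  exact isClosed_zeroSet ⟨0, isWeightedHomogeneous_rename_inl p⟩

theorem isClosed_setOf_sum_lam_mul_eval_base_eq_zero [Fintype ι]
    (p : Option ι → MvPolynomial (Option (Fin n)) ℂ) :
    IsClosed {P : TXL n ι | ∑ k, P.lam.rep k * eval P.base (p k) = 0} := by
  have h : {P : TXL n ι | ∑ k, P.lam.rep k * eval P.base (p k) = 0} =
      zeroSet (∑ k, X (Sum.inr k) * rename Sum.inl (p k)) := by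
    ext P
    simp only [zeroSet, Set.mem_ofPred_eq, map_sum, map_mul, eval_X, eval_rename,
      Sum.elim_comp_inl, Sum.elim_inr]
    rfl
  rw [h]
  refine isClosed_zeroSet ⟨1, IsWeightedHomogeneous.sum _ _ _ fun k _ => ?_⟩
  simpa [lamWeight] using (isWeightedHomogeneous_X ℂ (lamWeight n ι) (Sum.inr k)).mul
    (isWeightedHomogeneous_rename_inl (p k))

theorem eval_pow_weight_mul {R τ : Type*} [CommSemiring R] {w : τ → ℕ} {p : MvPolynomial τ R}
    {k : ℕ} (hp : IsWeightedHomogeneous w p k) (c : R) (v : τ → R) :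
    eval (fun i => c ^ w i * v i) p = c ^ k * eval v p := by
  rw [eval_eq, eval_eq, Finset.mul_sum]
  refine Finset.sum_congr rfl fun s hs => ?_
  rw [mul_left_comm, ← hp (mem_support_iff.1 hs), Finsupp.weight_apply, Finsupp.sum,
    ← Finset.prod_pow_eq_pow_sum, ← Finset.prod_mul_distrib]
  congr 1
  refine Finset.prod_congr rfl fun i _ => ?_
  rw [mul_pow, ← pow_mul, smul_eq_mul, mul_comm (w i)]

theorem ofCoords_mem_zeroSet {p : MvPolynomial (TXLVar n ι) ℂ} (hp : IsLamHomogeneous p)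
    (z : ℂ × (Fin n → ℂ) × {v : Option ι → ℂ // v ≠ 0}) :
    TXL.ofCoords z ∈ zeroSet p ↔
      eval (Sum.elim (fun o => o.elim z.1 z.2.1) z.2.2.1 : TXLVar n ι → ℂ) p = 0 := by
  obtain ⟨k, hk⟩ := hp
  obtain ⟨c, hc, hrep⟩ := TXL.exists_lam_rep_ofCoords z
  have hscale := eval_pow_weight_mul hk c
    (Sum.elim (fun o => o.elim z.1 z.2.1) z.2.2.1 : TXLVar n ι → ℂ)
  have hcoords : (fun i => c ^ Sum.elim (fun _ => 0) (fun _ => 1) i *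
      (Sum.elim (fun o => o.elim z.1 z.2.1) z.2.2.1 : TXLVar n ι → ℂ) i) =
      Sum.elim (fun o => o.elim z.1 z.2.1) (c • z.2.2.1) := by
    ext (i | i) <;> simp
  simp only [zeroSet, Set.mem_ofPred_eq, hrep]
  change eval (Sum.elim (fun o => o.elim z.1 z.2.1) (c • z.2.2.1)) p = 0 ↔ _
  rw [← hcoords, hscale, mul_eq_zero_iff_left (pow_ne_zero k hc)]

theorem continuous_ofCoords : Continuous (TXL.ofCoords (n := n) (ι := ι)) := by
  refine continuous_generateFrom_iff.2 ?_
  rintro U ⟨p, hp, rfl⟩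
  rw [Set.preimage_compl, isOpen_compl_iff]
  suffices IsClosed {z : ℂ × (Fin n → ℂ) × {v : Option ι → ℂ // v ≠ 0} |
      eval (Sum.elim (fun o => o.elim z.1 z.2.1) z.2.2.1 : TXLVar n ι → ℂ) p = 0} by
    simpa only [Set.preimage, ofCoords_mem_zeroSet hp] using this
  refine isClosed_eq ((MvPolynomial.continuous_eval p).comp (continuous_pi ?_)) continuous_const
  rintro ((_ | i) | i) <;> simp only [Sum.elim_inl, Sum.elim_inr, Option.elim]
  · fun_prop
  · fun_prop
  · exact (continuous_apply i).comp (continuous_subtype_val.comp (by fun_prop))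

end Zariski

section Components

variable {X : Type*} [TopologicalSpace X] [TopologicalSpace.NoetherianSpace X] {A : Set X}

theorem exists_mem_componentsOf_superset {W : Set X} (hA : IsClosed A) (hW : IsIrreducible W)
    (hWA : W ⊆ A) : ∃ Z ∈ componentsOf A, W ⊆ Z := by
  obtain ⟨T, hTf, hTc, hTi, rfl⟩ :=
    TopologicalSpace.NoetherianSpace.exists_finite_set_isClosed_irreducible hA
  have subset_member : ∀ W : Set X, IsIrreducible W → W ⊆ ⋃₀ T → ∃ Z ∈ T, W ⊆ Z :=
    fun W hW hWT => by
      simpa using isIrreducible_iff_sUnion_isClosed.1 hW hTf.toFinset (by simpa using hTc)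
        (by simpa using hWT)
  obtain ⟨Z, hZ, hWZ⟩ := subset_member W hW hWA
  obtain ⟨Y, hZY, hY⟩ := hTf.exists_le_maximal hZ
  refine ⟨Y, ⟨⟨hTi Y hY.prop, Set.subset_sUnion_of_mem hY.prop⟩, ?_⟩, hWZ.trans hZY⟩
  rintro B ⟨hB, hBT⟩ hYB
  obtain ⟨Y', hY', hBY'⟩ := subset_member B hB hBT
  exact hBY'.trans (hY.le_of_ge hY' (hYB.trans hBY'))

theorem isClosed_of_mem_componentsOf {X : Type*} [TopologicalSpace X] {A Z : Set X}
    (hA : IsClosed A) (hZ : Z ∈ componentsOf A) : IsClosed Z := by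
  obtain ⟨⟨hirr, hZA⟩, hmax⟩ := hZ
  exact isClosed_of_closure_subset
    (hmax ⟨hirr.closure, closure_minimal hZA hA⟩ subset_closure)

theorem exists_mem_componentsOf_eventually_mem {α : Type*} {l : Ultrafilter α} {u : α → X}
    (hA : IsClosed A) (hu : ∀ᶠ k in (l : Filter α), u k ∈ A) :
    ∃ Z ∈ componentsOf A, ∀ᶠ k in (l : Filter α), u k ∈ Z := by
  obtain ⟨T, hTf, -, hTi, rfl⟩ :=
    TopologicalSpace.NoetherianSpace.exists_finite_set_isClosed_irreducible hA
  obtain ⟨Y, hY, hYu⟩ : ∃ Y ∈ T, u ⁻¹' Y ∈ l :=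
    (Ultrafilter.finite_biUnion_mem_iff hTf).1
      (by rwa [← Set.preimage_iUnion₂, ← Set.sUnion_eq_biUnion])
  obtain ⟨Z, hZ, hYZ⟩ := exists_mem_componentsOf_superset hA (hTi Y hY)
    (Set.subset_sUnion_of_mem hY)
  exact ⟨Z, hZ, mem_of_superset hYu (Set.preimage_mono hYZ)⟩

end Components

section HatV

variable {K : Subfield ℝ} {n m : ℕ} {d : ℕ} {f : Fin m → MvPolynomial (Fin n) K}
  {g : MvPolynomial (Fin n) K} {S : Finset (Fin m)} {σ : S → ℤˣ}

/-- The polynomial `t p(x) + c (1 - t) p'(x)` in the variables `t` (`none`) and `x_j` (`some j`),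
of which the `F_i^±`, `G` and their partial derivatives are instances. -/
noncomputable def pencil (c : ℂ) (p p' : MvPolynomial (Fin n) ℂ) :
    MvPolynomial (Option (Fin n)) ℂ :=
  X none * rename some p + C c * (1 - X none) * rename some p'

theorem eval_base_pencil {ι : Type} (c : ℂ) (p p' : MvPolynomial (Fin n) ℂ) (P : TXL n ι) :
    eval P.base (pencil c p p') = P.t * eval P.x p + c * (1 - P.t) * eval P.x p' := by
  simp [pencil, eval_rename, TXL.base, Function.comp_def]

theorem eval_F (i : Fin m) (ε : ℤˣ) (t : ℂ) (x : Fin n → ℂ) :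
    eval x (F d f i ε t) =
      t * eval x (toComplex (f i)) + ((ε : ℤ) : ℂ) * (1 - t) * eval x (fTilde n d i) := by
  simp [F]

theorem eval_pderiv_F (i : Fin m) (ε : ℤˣ) (t : ℂ) (j : Fin n) (x : Fin n → ℂ) :
    eval x (pderiv j (F d f i ε t)) = t * eval x (pderiv j (toComplex (f i))) +
      ((ε : ℤ) : ℂ) * (1 - t) * eval x (pderiv j (fTilde n d i)) := by
  rw [F, map_add, pderiv_C_mul, pderiv_C_mul]
  simp

theorem eval_pderiv_G (t : ℂ) (j : Fin n) (x : Fin n → ℂ) :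
    eval x (pderiv j (G d g t)) = t * eval x (pderiv j (toComplex g)) +
      (1 - t) * eval x (pderiv j (gTilde n d)) := by
  simp only [G, map_add, pderiv_C_mul, map_mul, eval_C]

theorem isClosed_hatV : IsClosed (hatV d f g S σ) := by
  have h : hatV d f g S σ =
      (⋂ i : S, {P : TXL n S |
        eval P.base (pencil ((σ i : ℤ) : ℂ) (toComplex (f i)) (fTilde n d i.val)) = 0}) ∩
      ⋂ j : Fin n, {P : TXL n S | ∑ k, P.lam.rep k * eval P.base
        (k.elim (pencil 1 (pderiv j (toComplex g)) (pderiv j (gTilde n d))) fun i : S =>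
          -pencil ((σ i : ℤ) : ℂ) (pderiv j (toComplex (f i)))
            (pderiv j (fTilde n d i.val))) = 0} := by
    ext P
    simp only [hatV, Set.mem_ofPred_eq, Set.mem_inter_iff, Set.mem_iInter, Fintype.sum_option,
      Option.elim_none, Option.elim_some, map_neg, mul_neg, Finset.sum_neg_distrib,
      ← sub_eq_add_neg, sub_eq_zero, eval_base_pencil, eval_F, eval_pderiv_F, eval_pderiv_G,
      one_mul]
  rw [h]
  exact (isClosed_iInter fun i => isClosed_setOf_eval_base_eq_zero _).inter
    (isClosed_iInter fun j => isClosed_setOf_sum_lam_mul_eval_base_eq_zero _)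

theorem ofCoords_mem_hatV {t : ℂ} {x : Fin n → ℂ} {v : Option S → ℂ} (hv : v ≠ 0)
    (hF : ∀ i : S, eval x (F d f i (σ i) t) = 0)
    (hgrad : ∀ j : Fin n, v none * eval x (pderiv j (G d g t)) =
      ∑ i : S, v (some i) * eval x (pderiv j (F d f i (σ i) t))) :
    TXL.ofCoords ⟨t, x, v, hv⟩ ∈ hatV d f g S σ := by
  obtain ⟨c, -, hc⟩ := TXL.exists_lam_rep_ofCoords (⟨t, x, v, hv⟩ : _ × _ × _)
  refine ⟨hF, fun j => ?_⟩
  simp only [hc, Pi.smul_apply, smul_eq_mul, mul_assoc, ← Finset.mul_sum]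
  exact congrArg _ (hgrad j)

theorem ofCoords_mem_V_of_tendsto {α : Type*} {l : Ultrafilter α}
    {z : α → ℂ × (Fin n → ℂ) × {v : Option S → ℂ // v ≠ 0}}
    {z₀ : ℂ × (Fin n → ℂ) × {v : Option S → ℂ // v ≠ 0}} (hz : Tendsto z l (𝓝 z₀))
    (hmem : ∀ᶠ k in (l : Filter α), TXL.ofCoords (z k) ∈ hatV d f g S σ)
    (hne : ∀ᶠ k in (l : Filter α), (z k).1 ≠ z₀.1) :
    TXL.ofCoords z₀ ∈ V d f g S σ := by
  obtain ⟨Z, hZ, hzZ⟩ := exists_mem_componentsOf_eventually_mem isClosed_hatV hmem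
  have hz₀ : TXL.ofCoords z₀ ∈ Z := (isClosed_of_mem_componentsOf isClosed_hatV hZ).mem_of_tendsto
    ((continuous_ofCoords.tendsto z₀).comp hz) hzZ
  refine ⟨Z, ⟨hZ, ?_⟩, hz₀⟩
  rintro ⟨t₀, ht₀⟩
  obtain ⟨k, hk, hkne⟩ := (hzZ.and hne).exists
  have ht : (z k).1 = t₀ := ht₀ hk
  exact hkne (ht.trans (ht₀ hz₀).symm)

end HatV

section Cauchy

variable {k κ ν : Type*} [Field k]

/-- A matrix is totally nonsingular if all its square submatrices are nonsingular, as is the case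
for Cauchy matrices. -/
def TotallyNonsingular (M : Matrix κ ν k) : Prop :=
  ∀ (s : ℕ) (e : Fin s → κ) (e' : Fin s → ν), Function.Injective e → Function.Injective e' →
    (M.submatrix e e').det ≠ 0

theorem det_cauchy_ne_zero [Fintype ν] [DecidableEq ν] {p r : ν → k} (hp : Function.Injective p)
    (hr : Function.Injective r) (hpr : ∀ i j, p i ≠ r j) :
    (Matrix.of fun i j => 1 / (p i - r j)).det ≠ 0 := by
  classical
  intro hdet
  obtain ⟨c, hc₀, hc⟩ := Matrix.exists_mulVec_eq_zero_iff.2 hdet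
  -- By the barycentric formula, this interpolant vanishes at `p i` iff row `i` annihilates `c`.
  set P := Lagrange.interpolate Finset.univ r
    fun j => c j / Lagrange.nodalWeight Finset.univ r j with hP
  have hweight (j : ν) : Lagrange.nodalWeight Finset.univ r j ≠ 0 :=
    Lagrange.nodalWeight_ne_zero hr.injOn (Finset.mem_univ j)
  have hroot (i : ν) : P.eval (p i) = 0 := by
    rw [hP, Lagrange.eval_interpolate_not_at_node _ fun j _ => hpr i j]
    refine mul_eq_zero_of_right _ ((Finset.sum_congr rfl fun j _ => ?_).trans (congrFun hc i))
    simp only [Matrix.of_apply]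
    field_simp [hweight j]
  have hzero : P = 0 := by
    refine Polynomial.eq_zero_of_degree_lt_of_eval_finset_eq_zero (Finset.univ.image p) ?_ ?_
    · rw [Finset.card_image_of_injective _ hp]
      exact Lagrange.degree_interpolate_lt _ hr.injOn
    · simpa using hroot
  refine hc₀ (funext fun j => ?_)
  have hnode := Lagrange.eval_interpolate_at_node
    (fun j => c j / Lagrange.nodalWeight Finset.univ r j) hr.injOn (Finset.mem_univ j)
  rw [← hP, hzero, Polynomial.eval_zero] at hnode
  exact (div_eq_zero_iff.1 hnode.symm).resolve_right (hweight j)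

theorem totallyNonsingular_cauchy {p : κ → k} {r : ν → k} (hp : Function.Injective p)
    (hr : Function.Injective r) (hpr : ∀ i j, p i ≠ r j) :
    TotallyNonsingular (Matrix.of fun i j => 1 / (p i - r j)) :=
  fun _ _ _ he he' => det_cauchy_ne_zero (hp.comp he) (hr.comp he') fun _ _ => hpr _ _

namespace TotallyNonsingular

variable {M : Matrix κ ν k}

theorem transpose (hM : TotallyNonsingular M) : TotallyNonsingular M.transpose :=
  fun s e e' he he' => by
    rw [← Matrix.transpose_submatrix, Matrix.det_transpose]
    exact hM s e' e he' he

theorem comp_rows {κ' : Type*} (hM : TotallyNonsingular M) {e : κ' → κ}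
    (he : Function.Injective e) : TotallyNonsingular (M.submatrix e id) :=
  fun s e₁ e' he₁ he' => hM s (e ∘ e₁) e' (he.comp he₁) he'

theorem exists_sum_columns_eq [Fintype κ] (hM : TotallyNonsingular M) {J : Finset ν}
    (hJ : J.card = Fintype.card κ) (b : κ → k) :
    ∃ u : ν → k, ∀ i, ∑ j ∈ J, M i j * u j = b i := by
  classical
  let e := (Fintype.equivFin κ).symm
  let e' := (J.equivFinOfCardEq hJ).symm
  set N := M.submatrix e fun s => (e' s : ν) with hN
  have hdet : IsUnit N.det :=
    (hM _ e _ e.injective (Subtype.val_injective.comp e'.injective)).isUnit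
  set u := N⁻¹.mulVec (b ∘ e) with hu
  refine ⟨fun j => if hj : j ∈ J then u (e'.symm ⟨j, hj⟩) else 0, fun i => ?_⟩
  calc ∑ j ∈ J, M i j * (if hj : j ∈ J then u (e'.symm ⟨j, hj⟩) else 0)
      = ∑ j : J, M i j * u (e'.symm j) := by
        rw [← Finset.sum_coe_sort]
        exact Finset.sum_congr rfl fun j _ => by simp
    _ = N.mulVec u (e.symm i) := by
        rw [← e'.sum_comp]
        simp [Matrix.mulVec, dotProduct, hN]
    _ = b i := by simp [hu, Matrix.mulVec_mulVec, Matrix.mul_nonsing_inv _ hdet]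

theorem exists_sum_rows_eq [Fintype κ] (hM : TotallyNonsingular M) {J : Finset ν}
    (hJ : J.card = Fintype.card κ) (b : ν → k) :
    ∃ w : κ → k, ∀ j ∈ J, ∑ i, w i * M i j = b j := by
  have hMJ : TotallyNonsingular (M.submatrix id ((↑) : J → ν)).transpose :=
    hM.transpose.comp_rows Subtype.val_injective
  obtain ⟨w, hw⟩ := hMJ.exists_sum_columns_eq (J := Finset.univ) (by simp [hJ]) fun j => b j
  exact ⟨w, fun j hj => by simpa [mul_comm] using hw ⟨j, hj⟩⟩

end TotallyNonsingular

end Cauchy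

section Nodes

theorem infinite_primes_gt (n : ℕ) : {p : ℕ | p.Prime ∧ n + 1 < p}.Infinite :=
  (Nat.infinite_setOfPred_prime.sdiff (Set.finite_le_nat (n + 1))).mono fun _ hp =>
    ⟨hp.1, not_le.1 hp.2⟩

theorem succ_lt_q_succ (n i : ℕ) : n + 1 < q n (i + 1) :=
  (Nat.nth_mem_of_infinite (infinite_primes_gt n) i).2

theorem q_injective (n : ℕ) : Function.Injective (q n) := by
  rintro (_ | i) (_ | j) h
  · rfl
  · exact absurd h (succ_lt_q_succ n j).ne
  · exact absurd h (succ_lt_q_succ n i).ne'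
  · exact congrArg _ (Nat.nth_injective (infinite_primes_gt n) h)

theorem lt_q (n : ℕ) : ∀ i, n < q n i
  | 0 => Nat.lt_succ_self n
  | i + 1 => (Nat.lt_succ_self n).trans (succ_lt_q_succ n i)

theorem a_pos {n j : ℕ} (hj : j ≤ n) (i : ℕ) : 0 < a n i j :=
  one_div_pos.2 (sub_pos.2 (by exact_mod_cast hj.trans_lt (lt_q n i)))

theorem totallyNonsingular_a (n : ℕ) :
    TotallyNonsingular (Matrix.of fun (i : ℕ) (j : Fin n) => ((a n i (j.val + 1) : ℚ) : ℂ)) := by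
  have hcauchy := totallyNonsingular_cauchy (k := ℂ) (p := fun i => (q n i : ℂ))
    (r := fun j : Fin n => ((j.val + 1 : ℕ) : ℂ)) (Nat.cast_injective.comp (q_injective n))
    (Nat.cast_injective.comp ((add_left_injective 1).comp Fin.val_injective))
    (fun i j => Nat.cast_injective.ne (lt_of_le_of_lt j.isLt (lt_q n i)).ne')
  simpa [a] using hcauchy

end Nodes

section Filtration

open scoped Pointwise

variable {k R Q ν κ : Type*} [CommRing k] [CommRing R] [CommRing Q] [Algebra k R] [Algebra R Q]
  [Algebra k Q] [IsScalarTower k R Q]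

variable (R) in
/-- The values at `x` of the polynomials over `R` of total degree at most `D`. -/
noncomputable def degreeLE (x : ν → Q) (D : ℕ) : Submodule R Q :=
  (restrictTotalDegree ν R D).map (aeval x).toLinearMap

/-- The values at `x` of the polynomials of total degree at most `D` with leading form divisible
by `τ`. -/
noncomputable def perturbed (τ : R) (x : ν → Q) (D : ℕ) : Submodule R Q :=
  degreeLE R x (D - 1) ⊔ τ • degreeLE R x D

variable {τ : R} {x : ν → Q} {e : κ → Q} {D D' : ℕ}

theorem aeval_mem_degreeLE {p : MvPolynomial ν k} (hp : p.totalDegree ≤ D) :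
    aeval x p ∈ degreeLE R x D := by
  refine ⟨map (algebraMap k R) p, ?_, by simp [aeval_map_algebraMap]⟩
  exact (mem_restrictTotalDegree _ _ _).2 ((Finset.sup_mono (support_map_subset _ _)).trans hp)

theorem degreeLE_mono : Monotone (degreeLE R x) := fun _ _ h =>
  Submodule.map_mono fun p hp => (mem_restrictTotalDegree _ _ p).2
    (((mem_restrictTotalDegree _ _ p).1 hp).trans h)

theorem degreeLE_fg [Finite ν] (D : ℕ) : (degreeLE R x D).FG :=
  (Module.Finite.iff_fg.1 (inferInstance : Module.Finite R (restrictTotalDegree ν R D))).map _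

theorem degreeLE_mul_le : degreeLE R x D * degreeLE R x D' ≤ degreeLE R x (D + D') := by
  refine Submodule.mul_le.2 ?_
  rintro _ ⟨p, hp, rfl⟩ _ ⟨p', hp', rfl⟩
  refine ⟨p * p', (mem_restrictTotalDegree _ _ _).2 ?_, by simp⟩
  exact (totalDegree_mul _ _).trans (add_le_add ((mem_restrictTotalDegree _ _ _).1 hp)
    ((mem_restrictTotalDegree _ _ _).1 hp'))

theorem one_mem_degreeLE : (1 : Q) ∈ degreeLE R x D :=
  ⟨1, (mem_restrictTotalDegree _ _ _).2 (by simp), by simp⟩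

theorem prod_pow_mem_degreeLE (B : Finset ν) (α : ν → ℕ) :
    ∏ j ∈ B, x j ^ α j ∈ degreeLE R x (∑ j ∈ B, α j) := by
  have hdeg : (∏ j ∈ B, (X j : MvPolynomial ν R) ^ α j).totalDegree ≤ ∑ j ∈ B, α j :=
    (totalDegree_finsetProd _ _).trans
      (Finset.sum_le_sum fun j _ => (isHomogeneous_X_pow j (α j)).totalDegree_le)
  simpa using aeval_mem_degreeLE (R := R) (x := x) hdeg

theorem pow_mem_degreeLE (j : ν) (D : ℕ) : x j ^ D ∈ degreeLE R x D := by
  simpa using prod_pow_mem_degreeLE (R := R) (x := x) {j} fun _ => D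

theorem mem_perturbed_of_mem_degreeLE {y : Q} (hy : y ∈ degreeLE R x (D - 1)) :
    y ∈ perturbed τ x D :=
  Submodule.mem_sup_left hy

theorem smul_mem_perturbed {y : Q} (hy : y ∈ degreeLE R x D) : τ • y ∈ perturbed τ x D :=
  Submodule.mem_sup_right (Submodule.smul_mem_pointwise_smul _ _ _ hy)

theorem degreeLE_mul_perturbed_le (hD' : 1 ≤ D') :
    degreeLE R x D * perturbed τ x D' ≤ perturbed τ x (D + D') := by
  refine Submodule.mul_le.2 fun y hy z hz => ?_
  obtain ⟨u, hu, v, hv, rfl⟩ := Submodule.mem_sup.1 hz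
  obtain ⟨w, hw, rfl⟩ := (Submodule.mem_smul_pointwise_iff_exists _ _ _).1 hv
  rw [mul_add, mul_smul_comm]
  refine add_mem (mem_perturbed_of_mem_degreeLE ?_)
    (smul_mem_perturbed (degreeLE_mul_le (Submodule.mul_mem_mul hy hw)))
  rw [Nat.add_sub_assoc hD']
  exact degreeLE_mul_le (Submodule.mul_mem_mul hy hu)

theorem mul_mem_perturbed_mul {E : Submodule R Q} (hD' : 1 ≤ D') {y z : Q}
    (hy : y ∈ degreeLE R x D) (hz : z ∈ perturbed τ x D' * E) :
    y * z ∈ perturbed τ x (D + D') * E := by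
  refine mul_le_mul' (degreeLE_mul_perturbed_le hD') le_rfl ?_
  rw [mul_assoc]
  exact Submodule.mul_mem_mul hy hz

/-! ### Algebraic relations from the filtration -/

theorem exists_monic_aeval_mul_eq_zero {W : Submodule R Q} (hW : W.FG) {y : Q}
    (hy : ∀ w ∈ W, y * w ∈ W) :
    ∃ χ : Polynomial R, χ.Monic ∧ ∀ w ∈ W, Polynomial.aeval y χ * w = 0 := by
  have : Module.Finite R W := Module.Finite.iff_fg.2 hW
  set φ : Module.End R W := (LinearMap.mulLeft R y).restrict hy
  obtain ⟨χ, hχ, hχφ⟩ := LinearMap.exists_monic_and_aeval_eq_zero R φ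
  have pow_apply (i : ℕ) (w : W) : ((φ ^ i) w : Q) = y ^ i * w := by
    rw [Module.End.pow_restrict i hy, LinearMap.coe_restrict_apply, LinearMap.pow_mulLeft,
      LinearMap.mulLeft_apply]
  refine ⟨χ, hχ, fun w hw => ?_⟩
  have hχw : ((Polynomial.aeval φ χ ⟨w, hw⟩ : W) : Q) = 0 := by rw [hχφ]; rfl
  rw [← hχw]
  simp [Polynomial.aeval_eq_sum_range, Finset.sum_mul, pow_apply]

theorem exists_monic_aeval_smul_mul_eq_zero [Finite ν] [Finite κ]
    (h : degreeLE R x (D + 1) * Submodule.span R (Set.range e) ≤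
      perturbed τ x (D + 1) * Submodule.span R (Set.range e)) :
    ∃ s : R, s - 1 ∈ Ideal.span {τ} ∧ ∀ j, ∃ χ : Polynomial R, χ.Monic ∧
      ∀ i, Polynomial.aeval (s • x j) χ * e i = 0 := by
  set E := Submodule.span R (Set.range e)
  have hEfg : E.FG := Submodule.fg_span (Set.finite_range e)
  have hsup : degreeLE R x (D + 1) * E ≤
      degreeLE R x D * E ⊔ Ideal.span {τ} • (degreeLE R x (D + 1) * E) := by
    refine h.trans (Submodule.mul_le.2 fun y hy z hz => ?_)
    obtain ⟨u, hu, v, hv, rfl⟩ := Submodule.mem_sup.1 hy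
    obtain ⟨w, hw, rfl⟩ := (Submodule.mem_smul_pointwise_iff_exists _ _ _).1 hv
    rw [add_mul, smul_mul_assoc]
    exact add_mem (Submodule.mem_sup_left (Submodule.mul_mem_mul hu hz))
      (Submodule.mem_sup_right (Submodule.smul_mem_smul (Ideal.mem_span_singleton_self τ)
        (Submodule.mul_mem_mul hw hz)))
  obtain ⟨s, hs, hsE⟩ := Submodule.exists_sub_one_mem_and_smul_le_of_fg_of_le_sup
    ((degreeLE_fg (D + 1)).mul hEfg) le_rfl hsup
  refine ⟨s, hs, fun j => ?_⟩
  have hstable : ∀ w ∈ degreeLE R x D * E, s • x j * w ∈ degreeLE R x D * E := fun w hw => by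
    rw [smul_mul_assoc]
    refine hsE (Submodule.smul_mem_pointwise_smul _ _ _ ?_)
    rw [add_comm]
    refine mul_le_mul' degreeLE_mul_le le_rfl ?_
    rw [mul_assoc]
    exact Submodule.mul_mem_mul (by simpa using pow_mem_degreeLE j 1) hw
  obtain ⟨χ, hχ, hχ₀⟩ := exists_monic_aeval_mul_eq_zero ((degreeLE_fg D).mul hEfg) hstable
  refine ⟨χ, hχ, fun i => hχ₀ _ ?_⟩
  rw [← one_mul (e i)]
  exact Submodule.mul_mem_mul one_mem_degreeLE (Submodule.subset_span ⟨i, rfl⟩)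

end Filtration

section Reduction

variable {k R Q ν S : Type*} [Field k] [CommRing R] [CommRing Q] [Algebra k R] [Algebra R Q]
  [Algebra k Q] [IsScalarTower k R Q] [Fintype S] {d : ℕ} {τ : R} {x : ν → Q}

/-! ### Lowering the degree modulo `τ` -/

section Elimination

variable {M : Matrix (Option S) ν k} {e : Option S → Q}

theorem prod_pow_mul_mem_perturbed (hM : TotallyNonsingular M) (hd : 2 ≤ d)
    (hG : ∀ j, x j ^ (d - 1) * ∑ i, M i j • e i ∈
      perturbed τ x (d - 1) * Submodule.span R (Set.range e))
    {B : Finset ν} (hB : B.card = Fintype.card S + 1) (i₀ : Option S) :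
    (∏ j ∈ B, x j ^ d) * e i₀ ∈
      perturbed τ x (d * (Fintype.card S + 1)) * Submodule.span R (Set.range e) := by
  classical
  obtain ⟨u, hu⟩ := hM.exists_sum_columns_eq (J := B) (by simpa using hB) (Pi.single i₀ 1)
  have he : e i₀ = ∑ j ∈ B, u j • ∑ i, M i j • e i := by
    simp only [Finset.smul_sum, smul_smul]
    rw [Finset.sum_comm]
    simp only [← Finset.sum_smul, mul_comm (u _), hu]
    simp [Pi.single_apply]
  rw [he, Finset.mul_sum]
  refine Submodule.sum_mem _ fun j hj => ?_
  rw [mul_smul_comm]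
  refine Submodule.smul_of_tower_mem _ _ ?_
  have hprod : ∏ i ∈ B, x i ^ d = (x j ^ 1 * ∏ i ∈ B.erase j, x i ^ d) * x j ^ (d - 1) := by
    rw [← Finset.mul_prod_erase _ _ hj, ← pow_sub_mul_pow (x j) (show 1 ≤ d by omega)]
    ring
  have hdeg : d * (Fintype.card S + 1) = (1 + ∑ _i ∈ B.erase j, d) + (d - 1) := by
    rw [Finset.sum_const, Finset.card_erase_of_mem hj, hB, smul_eq_mul, Nat.add_sub_cancel,
      mul_comm _ d, mul_add]
    omega
  rw [hprod, hdeg, mul_assoc]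
  exact mul_mem_perturbed_mul (by omega) (degreeLE_mul_le
    (Submodule.mul_mem_mul (pow_mem_degreeLE j 1) (prod_pow_mem_degreeLE _ _))) (hG j)

variable [Fintype ν]

theorem exists_pow_add_sum_compl_mem_perturbed [DecidableEq ν] (hM : TotallyNonsingular M)
    (hF : ∀ i : S, ∑ j, M (some i) j • x j ^ d ∈ perturbed τ x d)
    {J : Finset ν} (hJ : J.card = Fintype.card S) {j₀ : ν} (hj₀ : j₀ ∈ J) :
    ∃ c : ν → k, x j₀ ^ d + ∑ j ∈ Jᶜ, c j • x j ^ d ∈ perturbed τ x d := by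
  obtain ⟨w, hw⟩ := (hM.comp_rows (Option.some_injective S)).exists_sum_rows_eq hJ (Pi.single j₀ 1)
  refine ⟨fun j => ∑ i, w i * M (some i) j, ?_⟩
  have hsum : ∑ i, w i • ∑ j, M (some i) j • x j ^ d ∈ perturbed τ x d :=
    Submodule.sum_mem _ fun i _ => Submodule.smul_of_tower_mem _ _ (hF i)
  convert hsum using 1
  simp only [Finset.smul_sum, smul_smul]
  rw [Finset.sum_comm]
  simp only [← Finset.sum_smul]
  rw [← Finset.sum_add_sum_compl J, Finset.sum_eq_single_of_mem j₀ hj₀ fun j hj hne => ?_]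
  · simpa using congrArg (· • x j₀ ^ d) (hw j₀ hj₀).symm
  · simpa [hne] using congrArg (· • x j ^ d) (hw j hj)

theorem pow_mul_prod_pow_mul_mem_perturbed (hM : TotallyNonsingular M) (hd : 2 ≤ d)
    (hS : Fintype.card S ≤ Fintype.card ν)
    (hF : ∀ i : S, ∑ j, M (some i) j • x j ^ d ∈ perturbed τ x d)
    (hG : ∀ j, x j ^ (d - 1) * ∑ i, M i j • e i ∈
      perturbed τ x (d - 1) * Submodule.span R (Set.range e))
    (r : ℕ) (B : Finset ν) {j₀ : ν} (hj₀ : j₀ ∈ B) (hB : B.card + r = Fintype.card S + 1)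
    (i₀ : Option S) :
    x j₀ ^ (d * r) * (∏ j ∈ B, x j ^ d) * e i₀ ∈
      perturbed τ x (d * (Fintype.card S + 1)) * Submodule.span R (Set.range e) := by
  classical
  induction r generalizing B with
  | zero => simpa using prod_pow_mul_mem_perturbed hM hd hG (by simpa using hB) i₀
  | succ r ih =>
    obtain ⟨J, hBJ, hJ⟩ := Finset.exists_superset_card_eq (s := B) (n := Fintype.card S)
      (by omega) (by simpa using hS)
    have notMem {j : ν} (hj : j ∈ Jᶜ) : j ∉ B := fun h => Finset.mem_compl.1 hj (hBJ h)
    obtain ⟨c, hc⟩ := exists_pow_add_sum_compl_mem_perturbed hM hF hJ (hBJ hj₀)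
    have hsplit : x j₀ ^ (d * (r + 1)) * (∏ j ∈ B, x j ^ d) * e i₀ =
        (x j₀ ^ (d * r) * ∏ j ∈ B, x j ^ d) * ((x j₀ ^ d + ∑ j ∈ Jᶜ, c j • x j ^ d) * e i₀) -
          ∑ j ∈ Jᶜ, c j • (x j₀ ^ (d * r) * (∏ i ∈ insert j B, x i ^ d) * e i₀) := by
      have hterm : ∀ j ∈ Jᶜ, c j • (x j₀ ^ (d * r) * (∏ i ∈ insert j B, x i ^ d) * e i₀) =
          (x j₀ ^ (d * r) * ∏ i ∈ B, x i ^ d) * (c j • x j ^ d) * e i₀ := fun j hj => by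
        rw [Finset.prod_insert (notMem hj), mul_smul_comm, smul_mul_assoc]
        ring_nf
      rw [Finset.sum_congr rfl hterm, ← Finset.sum_mul, ← Finset.mul_sum]
      ring
    rw [hsplit]
    refine Submodule.sub_mem _ ?_ (Submodule.sum_mem _ fun j hj => Submodule.smul_of_tower_mem _ _
      (ih _ (Finset.mem_insert_of_mem hj₀)
        (by rw [Finset.card_insert_of_notMem (notMem hj)]; omega)))
    have hdeg : d * (Fintype.card S + 1) = (d * r + ∑ _i ∈ B, d) + d := by
      rw [← hB, Finset.sum_const, smul_eq_mul]
      ring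
    rw [hdeg]
    exact mul_mem_perturbed_mul (by omega) (degreeLE_mul_le
      (Submodule.mul_mem_mul (pow_mem_degreeLE _ _) (prod_pow_mem_degreeLE _ _)))
      (Submodule.mul_mem_mul hc (Submodule.subset_span ⟨i₀, rfl⟩))

theorem pow_mul_mem_perturbed (hM : TotallyNonsingular M) (hd : 2 ≤ d)
    (hS : Fintype.card S ≤ Fintype.card ν)
    (hF : ∀ i : S, ∑ j, M (some i) j • x j ^ d ∈ perturbed τ x d)
    (hG : ∀ j, x j ^ (d - 1) * ∑ i, M i j • e i ∈
      perturbed τ x (d - 1) * Submodule.span R (Set.range e))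
    (j : ν) (i : Option S) :
    x j ^ (d * (Fintype.card S + 1)) * e i ∈
      perturbed τ x (d * (Fintype.card S + 1)) * Submodule.span R (Set.range e) := by
  simpa only [Finset.prod_singleton, ← pow_add, ← mul_add_one] using
    pow_mul_prod_pow_mul_mem_perturbed hM hd hS hF hG (Fintype.card S) {j}
      (Finset.mem_singleton_self j) (by rw [Finset.card_singleton, add_comm]) i

end Elimination

variable [Fintype ν] {c : ℕ} {E : Submodule R Q}

theorem prod_pow_mul_mem_perturbed_of_pow_mul_mem (hc : 1 ≤ c)
    (h : ∀ j, ∀ w ∈ E, x j ^ c * w ∈ perturbed τ x c * E) {α : ν → ℕ}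
    (hα : ∑ j, α j = Fintype.card ν * c + 1) {w : Q} (hw : w ∈ E) :
    (∏ j, x j ^ α j) * w ∈ perturbed τ x (Fintype.card ν * c + 1) * E := by
  classical
  obtain ⟨j, hj⟩ : ∃ j, c ≤ α j := by
    by_contra! hlt
    have hsum : ∑ j, α j ≤ ∑ _j : ν, c := Finset.sum_le_sum fun j _ => (hlt j).le
    simp only [Finset.sum_const, Finset.card_univ, smul_eq_mul] at hsum
    omega
  have hprod : ∏ i, x i ^ α i =
      (x j ^ (α j - c) * ∏ i ∈ Finset.univ.erase j, x i ^ α i) * x j ^ c := by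
    rw [← Finset.mul_prod_erase _ _ (Finset.mem_univ j), ← pow_sub_mul_pow (x j) hj]
    ring
  have hdeg : Fintype.card ν * c + 1 = (α j - c + ∑ i ∈ Finset.univ.erase j, α i) + c := by
    rw [← hα, ← Finset.add_sum_erase _ _ (Finset.mem_univ j)]
    omega
  rw [hprod, hdeg, mul_assoc]
  exact mul_mem_perturbed_mul hc (degreeLE_mul_le
    (Submodule.mul_mem_mul (pow_mem_degreeLE _ _) (prod_pow_mem_degreeLE _ _))) (h j w hw)

theorem degreeLE_mul_le_perturbed_mul_of_pow_mul_mem (hc : 1 ≤ c)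
    (h : ∀ j, ∀ w ∈ E, x j ^ c * w ∈ perturbed τ x c * E) :
    degreeLE R x (Fintype.card ν * c + 1) * E ≤ perturbed τ x (Fintype.card ν * c + 1) * E := by
  refine Submodule.mul_le.2 ?_
  rintro _ ⟨p, hp, rfl⟩ w hw
  rw [AlgHom.toLinearMap_apply, aeval_def, eval₂_eq', Finset.sum_mul]
  refine Submodule.sum_mem _ fun s hs => ?_
  rw [← Algebra.smul_def, smul_mul_assoc]
  refine Submodule.smul_mem _ _ ?_
  have hdeg : ∑ j, s j ≤ Fintype.card ν * c + 1 := by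
    rw [← Finsupp.sum_fintype s (fun _ b => b) fun _ => rfl]
    exact (le_totalDegree hs).trans ((mem_restrictTotalDegree _ _ _).1 hp)
  rcases hdeg.lt_or_eq with hlt | heq
  · exact Submodule.mul_mem_mul (mem_perturbed_of_mem_degreeLE
      (degreeLE_mono (Nat.lt_succ_iff.1 hlt) (prod_pow_mem_degreeLE _ _))) hw
  · exact prod_pow_mul_mem_perturbed_of_pow_mul_mem hc h heq hw

theorem exists_degreeLE_mul_span_le_perturbed_mul {M : Matrix (Option S) ν k} {e : Option S → Q}
    (hM : TotallyNonsingular M) (hd : 2 ≤ d) (hS : Fintype.card S ≤ Fintype.card ν)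
    (hF : ∀ i : S, ∑ j, M (some i) j • x j ^ d ∈ perturbed τ x d)
    (hG : ∀ j, x j ^ (d - 1) * ∑ i, M i j • e i ∈
      perturbed τ x (d - 1) * Submodule.span R (Set.range e)) :
    ∃ D, degreeLE R x (D + 1) * Submodule.span R (Set.range e) ≤
      perturbed τ x (D + 1) * Submodule.span R (Set.range e) := by
  refine ⟨_, degreeLE_mul_le_perturbed_mul_of_pow_mul_mem
    (c := d * (Fintype.card S + 1)) (Nat.mul_pos (by omega) (Nat.succ_pos _)) fun j w hw => ?_⟩
  induction hw using Submodule.span_induction with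
  | zero => rw [mul_zero]; exact Submodule.zero_mem _
  | add y z _ _ hy hz => rw [mul_add (x j ^ _)]; exact Submodule.add_mem _ hy hz
  | smul b y _ hy => rw [mul_smul_comm]; exact Submodule.smul_mem _ _ hy
  | mem y hy =>
    obtain ⟨i, rfl⟩ := hy
    exact pow_mul_mem_perturbed hM hd hS hF hG j i

end Reduction

/-! ### Leading forms of the initial polynomials -/

section Degree

variable {ν k : Type*}

theorem totalDegree_pderiv_le [CommSemiring k] (p : MvPolynomial ν k) (j : ν) :
    (pderiv j p).totalDegree ≤ p.totalDegree - 1 := by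
  refine Finset.sup_le fun s hs => ?_
  have hcoeff : s + Finsupp.single j 1 ∈ p.support := by
    rw [mem_support_iff, coeff_pderiv] at hs
    exact mem_support_iff.2 (left_ne_zero_of_mul hs)
  have hle := le_totalDegree hcoeff
  rw [Finsupp.sum_add_index' (fun _ => rfl) (fun _ _ _ => rfl),
    Finsupp.sum_single_index rfl] at hle
  omega

theorem totalDegree_C_mul_le [CommSemiring k] (c : k) (p : MvPolynomial ν k) :
    (C c * p).totalDegree ≤ p.totalDegree := by
  simpa using totalDegree_mul (C c) p

theorem totalDegree_aeval_X_sub_le [CommRing k] {p : Polynomial k} {D : ℕ}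
    (hp : p.natDegree ≤ D) (j : ν) :
    (Polynomial.aeval (X j : MvPolynomial ν k) p - C (p.coeff D) * X j ^ D).totalDegree ≤
      D - 1 := by
  rw [Polynomial.aeval_eq_sum_range' (Nat.lt_succ_of_le hp), Finset.sum_range_succ,
    smul_eq_C_mul, add_sub_cancel_right]
  refine totalDegree_finsetSum_le fun i hi => (totalDegree_smul_le _ _).trans ?_
  exact (isHomogeneous_X_pow j i).totalDegree_le.trans
    (Nat.le_sub_one_of_lt (Finset.mem_range.1 hi))

theorem totalDegree_toComplex_le {K : Subfield ℝ} {n : ℕ} (p : MvPolynomial (Fin n) K) :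
    (toComplex p).totalDegree ≤ p.totalDegree :=
  Finset.sup_mono (support_map_subset _ _)

end Degree

section Chebyshev

variable {n m d : ℕ}

theorem natDegree_T_le (d : ℕ) : (Polynomial.Chebyshev.T ℂ (d : ℤ)).natDegree ≤ d := by
  rw [Polynomial.Chebyshev.natDegree_T, Int.natAbs_natCast]

theorem coeff_T_self (d : ℕ) : (Polynomial.Chebyshev.T ℂ (d : ℤ)).coeff d = 2 ^ (d - 1) := by
  simpa [Polynomial.leadingCoeff] using Polynomial.Chebyshev.leadingCoeff_T ℂ (d : ℤ)

theorem coeff_derivative_T_pred (hd : 1 ≤ d) :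
    (Polynomial.derivative (Polynomial.Chebyshev.T ℂ (d : ℤ))).coeff (d - 1) =
      2 ^ (d - 1) * d := by
  rw [Polynomial.coeff_derivative, Nat.sub_add_cancel hd, coeff_T_self, Nat.cast_sub hd]
  simp

theorem totalDegree_fTilde_sub_le (i : Fin m) :
    (fTilde n d i - C (2 ^ (d - 1)) *
      ∑ j : Fin n, C ((a n (i.val + 1) (j.val + 1) : ℚ) : ℂ) * X j ^ d).totalDegree ≤ d - 1 := by
  have heq : fTilde n d i - C (2 ^ (d - 1)) *
      ∑ j : Fin n, C ((a n (i.val + 1) (j.val + 1) : ℚ) : ℂ) * X j ^ d =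
      C ((a n (i.val + 1) 0 : ℚ) : ℂ) + ∑ j : Fin n, C ((a n (i.val + 1) (j.val + 1) : ℚ) : ℂ) *
        ((chebVar d j - C ((Polynomial.Chebyshev.T ℂ (d : ℤ)).coeff d) * X j ^ d) + 1) := by
    rw [fTilde, coeff_T_self, add_sub_assoc, Finset.mul_sum, ← Finset.sum_sub_distrib]
    exact congrArg _ (Finset.sum_congr rfl fun j _ => by ring)
  rw [heq]
  refine (totalDegree_add _ _).trans (max_le (by simp) (totalDegree_finsetSum_le fun j _ => ?_))
  refine (totalDegree_C_mul_le _ _).trans ((totalDegree_add _ _).trans (max_le ?_ (by simp)))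
  exact totalDegree_aeval_X_sub_le (natDegree_T_le d) j

theorem pderiv_chebVar (i j : Fin n) : pderiv j (chebVar d i) =
    if i = j then Polynomial.aeval (X j)
      (Polynomial.derivative (Polynomial.Chebyshev.T ℂ (d : ℤ))) else 0 := by
  rw [chebVar, Derivation.map_aeval, pderiv_X, smul_eq_mul]
  rcases eq_or_ne i j with rfl | hij
  · simp
  · simp [hij]

theorem pderiv_gTilde (n d : ℕ) (j : Fin n) : pderiv j (gTilde n d) =
    C ((a n 0 (j.val + 1) : ℚ) : ℂ) * Polynomial.aeval (X j)
      (Polynomial.derivative (Polynomial.Chebyshev.T ℂ (d : ℤ))) := by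
  simp [gTilde, pderiv_chebVar]

theorem pderiv_fTilde (i : Fin m) (j : Fin n) : pderiv j (fTilde n d i) =
    C ((a n (i.val + 1) (j.val + 1) : ℚ) : ℂ) * Polynomial.aeval (X j)
      (Polynomial.derivative (Polynomial.Chebyshev.T ℂ (d : ℤ))) := by
  simp [fTilde, pderiv_chebVar]

theorem totalDegree_C_mul_derivative_T_sub_le (hd : 1 ≤ d) (c : ℂ) (j : Fin n) :
    (C c * Polynomial.aeval (X j) (Polynomial.derivative (Polynomial.Chebyshev.T ℂ (d : ℤ))) -
      C (2 ^ (d - 1) * d * c) * X j ^ (d - 1)).totalDegree ≤ d - 1 - 1 := by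
  have hT := totalDegree_aeval_X_sub_le (ν := Fin n) (D := d - 1)
    ((Polynomial.natDegree_derivative_le _).trans (Nat.sub_le_sub_right (natDegree_T_le d) 1)) j
  have hcT := (totalDegree_C_mul_le c _).trans hT
  rwa [coeff_derivative_T_pred hd, mul_sub, ← mul_assoc, ← C_mul, mul_comm c] at hcT

end Chebyshev

section LeadingForm

variable {k R Q ν κ : Type*} [CommRing k] [CommRing R] [CommRing Q] [Algebra k R] [Algebra R Q]
  [Algebra k Q] [IsScalarTower k R Q] [Fintype κ] {τ : R} {x : ν → Q} {e : κ → Q} {D : ℕ}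

theorem sum_leadingForm_mul_mem_perturbed_mul {p p' ℓ : κ → MvPolynomial ν k}
    (hp : ∀ i, (p i).totalDegree ≤ D) (hp' : ∀ i, (p' i - ℓ i).totalDegree ≤ D - 1)
    (hℓ : ∀ i, (ℓ i).totalDegree ≤ D)
    (h : ∑ i, (τ • aeval x (p i) + (1 - τ) • aeval x (p' i)) * e i = 0) :
    ∑ i, aeval x (ℓ i) * e i ∈ perturbed τ x D * Submodule.span R (Set.range e) := by
  have heq : ∑ i, aeval x (ℓ i) * e i =
      ∑ i, (τ • aeval x (p' i - ℓ i + ℓ i - p i) - aeval x (p' i - ℓ i)) * e i := by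
    rw [← sub_eq_zero, ← Finset.sum_sub_distrib, ← h]
    refine Finset.sum_congr rfl fun i _ => ?_
    simp only [map_sub, map_add, sub_smul, smul_sub, smul_add, one_smul]
    ring
  rw [heq]
  refine Submodule.sum_mem _ fun i _ => Submodule.mul_mem_mul (sub_mem
    (smul_mem_perturbed (aeval_mem_degreeLE ?_))
    (mem_perturbed_of_mem_degreeLE (aeval_mem_degreeLE (hp' i)))) (Submodule.subset_span ⟨i, rfl⟩)
  refine (totalDegree_sub _ _).trans
    (max_le ((totalDegree_add _ _).trans (max_le ?_ (hℓ i))) (hp i))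
  exact (hp' i).trans (Nat.sub_le D 1)

theorem leadingForm_mem_perturbed {p p' ℓ : MvPolynomial ν k}
    (hp : p.totalDegree ≤ D) (hp' : (p' - ℓ).totalDegree ≤ D - 1) (hℓ : ℓ.totalDegree ≤ D)
    (h : τ • aeval x p + (1 - τ) • aeval x p' = 0) : aeval x ℓ ∈ perturbed τ x D := by
  simpa [Submodule.one_eq_span.symm] using sum_leadingForm_mul_mem_perturbed_mul (κ := Unit)
    (e := fun _ => (1 : Q)) (x := x) (τ := τ) (fun _ => hp) (fun _ => hp') (fun _ => hℓ)
    (by simpa using h)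

end LeadingForm

/-! ### Finiteness -/

theorem exists_ne_zero_aeval_mul_eq_zero {k R Q ν S : Type*} [Field k] [CommRing R] [IsDomain R]
    [CommRing Q] [Algebra k R] [Algebra R Q] [Algebra k Q] [IsScalarTower k R Q] [Fintype ν]
    [Fintype S] {d : ℕ} {τ : R} {x : ν → Q} {M : Matrix (Option S) ν k} {e : Option S → Q}
    (hτ : ¬IsUnit τ) (hM : TotallyNonsingular M) (hd : 2 ≤ d)
    (hS : Fintype.card S ≤ Fintype.card ν)
    (hF : ∀ i : S, ∑ j, M (some i) j • x j ^ d ∈ perturbed τ x d)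
    (hG : ∀ j, x j ^ (d - 1) * ∑ i, M i j • e i ∈
      perturbed τ x (d - 1) * Submodule.span R (Set.range e)) (j : ν) :
    ∃ Φ : Polynomial R, Φ ≠ 0 ∧ ∀ i, Polynomial.aeval (x j) Φ * e i = 0 := by
  obtain ⟨D, hD⟩ := exists_degreeLE_mul_span_le_perturbed_mul hM hd hS hF hG
  obtain ⟨s, hs, hχ⟩ := exists_monic_aeval_smul_mul_eq_zero hD
  obtain ⟨χ, hmonic, hχ⟩ := hχ j
  have hs₀ : s ≠ 0 := by
    rintro rfl
    exact hτ (isUnit_of_dvd_unit (Ideal.mem_span_singleton.1 hs) (by simp))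
  refine ⟨χ.comp (Polynomial.C s * Polynomial.X), fun h => ?_, fun i => ?_⟩
  · rcases Polynomial.comp_eq_zero_iff.1 h with h | ⟨-, h⟩
    · exact hmonic.ne_zero h
    · simpa [hs₀] using congrArg (Polynomial.coeff · 1) h
  · simpa [Polynomial.aeval_comp, Algebra.smul_def] using hχ i

theorem mem_of_smul_mem_of_tower {k R Q : Type*} [Field k] [CommRing R] [CommRing Q] [Algebra k R]
    [Algebra R Q] [Algebra k Q] [IsScalarTower k R Q] {W : Submodule R Q} {c : k} (hc : c ≠ 0)
    {y : Q} (h : c • y ∈ W) : y ∈ W :=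
  (Submodule.smul_mem_iff (W.restrictScalars k) hc).1 h

section CoordinateRing

variable {n : ℕ} {ι : Type} {A : Set (TXL n ι)}

/-- The algebra structure over `ℂ[t]` of the functions on a subset of `𝔸 × 𝔸ⁿ × ℙ^ι`, the variable
acting as the coordinate `t`. -/
noncomputable local instance functionAlgebra (A : Set (TXL n ι)) :
    Algebra (Polynomial ℂ) (A → ℂ) :=
  (Polynomial.aeval fun P : A => P.1.t).toAlgebra

local instance isScalarTower_functionAlgebra (A : Set (TXL n ι)) :
    IsScalarTower ℂ (Polynomial ℂ) (A → ℂ) :=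
  IsScalarTower.of_algebraMap_eq fun c =>
    (AlgHom.commutes (Polynomial.aeval fun P : A => P.1.t) c).symm

theorem algebraMap_functionAlgebra_apply (r : Polynomial ℂ) (P : A) :
    algebraMap (Polynomial ℂ) (A → ℂ) r P = r.eval P.1.t := by
  change Polynomial.aeval (fun P : A => P.1.t) r P = _
  simp [Polynomial.aeval_fn_apply]

theorem smul_functionAlgebra_apply (r : Polynomial ℂ) (y : A → ℂ) (P : A) :
    (r • y) P = r.eval P.1.t * y P := by
  rw [Algebra.smul_def, Pi.mul_apply, algebraMap_functionAlgebra_apply]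

theorem polynomial_aeval_functionAlgebra_apply (y : A → ℂ) (Φ : Polynomial (Polynomial ℂ))
    (P : A) :
    Polynomial.aeval y Φ P = (Φ.map (Polynomial.evalRingHom P.1.t)).eval (y P) := by
  rw [Polynomial.aeval_eq_sum_range, Polynomial.eval_map, Polynomial.eval₂_eq_sum_range]
  simp [smul_functionAlgebra_apply]

/-- The coordinates `x_j` as functions on a subset of `𝔸 × 𝔸ⁿ × ℙ^ι`. -/
def xCoord (A : Set (TXL n ι)) (j : Fin n) (P : A) : ℂ := P.1.x j

theorem aeval_xCoord_apply (p : MvPolynomial (Fin n) ℂ) (P : A) :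
    aeval (xCoord A) p P = eval P.1.x p := by
  rw [← coe_aeval_eq_eval]
  exact comp_aeval_apply (f := xCoord A) (Pi.evalAlgHom ℂ (fun _ : A => ℂ) P) p

theorem smul_aeval_xCoord_add_apply (p p' : MvPolynomial (Fin n) ℂ) (P : A) :
    ((Polynomial.X : Polynomial ℂ) • aeval (xCoord A) p +
      (1 - Polynomial.X : Polynomial ℂ) • aeval (xCoord A) p') P =
      P.1.t * eval P.1.x p + (1 - P.1.t) * eval P.1.x p' := by
  rw [Pi.add_apply, smul_functionAlgebra_apply, smul_functionAlgebra_apply, aeval_xCoord_apply,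
    aeval_xCoord_apply]
  simp

variable {K : Subfield ℝ} {m d : ℕ} {f : Fin m → MvPolynomial (Fin n) K}
  {g : MvPolynomial (Fin n) K} {S : Finset (Fin m)} {σ : S → ℤˣ}

/-- The polynomials `g` (`none`) and `σ_i f_i` (`some i`) reached by the deformation at `t = 1`. -/
noncomputable def targetPoly (f : Fin m → MvPolynomial (Fin n) K) (g : MvPolynomial (Fin n) K)
    (σ : S → ℤˣ) : Option S → MvPolynomial (Fin n) ℂ
  | none => toComplex g
  | some i => C ((σ i : ℤ) : ℂ) * toComplex (f i)

/-- The polynomials `g̃` (`none`) and `f̃_i` (`some i`) from which the deformation starts. -/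
noncomputable def initialPoly (n d : ℕ) (S : Finset (Fin m)) : Option S → MvPolynomial (Fin n) ℂ
  | none => gTilde n d
  | some i => fTilde n d i.val

/-- The coordinates `λ_0` (`none`) and `-σ_i λ_i` (`some i`) as functions on `V̂_{S,σ}`: the signs
turn its gradient equation into a linear combination of the gradients of
`t * targetPoly + (1 - t) * initialPoly`. -/
noncomputable def multiplier : Option S → hatV d f g S σ → ℂ
  | none, P => P.1.lam.rep none
  | some i, P => -((σ i : ℤ) : ℂ) * P.1.lam.rep (some i)

/-- The rows `0` (`none`) and `i` (`some i`) of the Cauchy matrix. -/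
noncomputable def cauchyRows (n : ℕ) (S : Finset (Fin m)) : Matrix (Option S) (Fin n) ℂ :=
  .of fun k j => ((a n (k.elim 0 fun i => i.val.val + 1) (j.val + 1) : ℚ) : ℂ)

theorem totallyNonsingular_cauchyRows (n : ℕ) (S : Finset (Fin m)) :
    TotallyNonsingular (cauchyRows n S) := by
  have hrow : Function.Injective fun k : Option S => k.elim 0 fun i => i.val.val + 1 := by
    rintro (_ | i) (_ | i') h
    · rfl
    · exact absurd h (Nat.succ_ne_zero _).symm
    · exact absurd h (Nat.succ_ne_zero _)
    · exact congrArg some (Subtype.ext (Fin.ext (Nat.succ_injective h)))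
  exact (totallyNonsingular_a n).comp_rows hrow

theorem totalDegree_targetPoly_le (hf : ∀ i, (f i).totalDegree ≤ d) (hg : g.totalDegree ≤ d) :
    ∀ k, (targetPoly f g σ k).totalDegree ≤ d
  | none => (totalDegree_toComplex_le g).trans hg
  | some i => (totalDegree_C_mul_le _ _).trans ((totalDegree_toComplex_le _).trans (hf i))

theorem pderiv_initialPoly (j : Fin n) (k : Option S) : pderiv j (initialPoly n d S k) =
    C (cauchyRows n S k j) * Polynomial.aeval (X j)
      (Polynomial.derivative (Polynomial.Chebyshev.T ℂ (d : ℤ))) := by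
  cases k
  · exact pderiv_gTilde n d j
  · exact pderiv_fTilde _ j

theorem unitsInt_cast_mul_self (R : Type*) [Ring R] (ε : ℤˣ) :
    ((ε : ℤ) : R) * ((ε : ℤ) : R) = 1 := by
  rw [← Int.cast_mul, ← Units.val_mul, Int.units_mul_self, Units.val_one, Int.cast_one]

theorem exists_multiplier_ne_zero (P : hatV d f g S σ) : ∃ k, multiplier k P ≠ 0 := by
  by_contra! h
  refine P.1.lam.rep_nonzero (funext fun k => ?_)
  cases k with
  | none => exact h none
  | some i =>
    exact (mul_eq_zero.1 (h (some i))).resolve_left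
      (neg_ne_zero.2 (left_ne_zero_of_mul_eq_one (unitsInt_cast_mul_self ℂ (σ i))))

theorem constraint_of_mem_hatV (P : hatV d f g S σ) (i : S) :
    P.1.t * eval P.1.x (targetPoly f g σ (some i)) +
      (1 - P.1.t) * eval P.1.x (initialPoly n d S (some i)) = 0 := by
  have h := P.2.1 i
  rw [eval_F] at h
  simp only [targetPoly, initialPoly, map_mul, eval_C]
  linear_combination ((σ i : ℤ) : ℂ) * h -
    (1 - P.1.t) * eval P.1.x (fTilde n d i.val) * unitsInt_cast_mul_self ℂ (σ i)

theorem gradient_of_mem_hatV (P : hatV d f g S σ) (j : Fin n) :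
    ∑ k, (P.1.t * eval P.1.x (pderiv j (targetPoly f g σ k)) +
      (1 - P.1.t) * eval P.1.x (pderiv j (initialPoly n d S k))) * multiplier k P = 0 := by
  have h := P.2.2 j
  simp only [eval_pderiv_F, eval_pderiv_G] at h
  simp only [Fintype.sum_option, targetPoly, initialPoly, multiplier, pderiv_C_mul, map_mul,
    eval_C]
  rw [mul_comm, h, ← Finset.sum_add_distrib]
  refine Finset.sum_eq_zero fun i _ => ?_
  linear_combination (-P.1.lam.rep (some i) * P.1.t *
    eval P.1.x (pderiv j (toComplex (f i)))) * unitsInt_cast_mul_self ℂ (σ i)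

theorem sum_cauchyRows_smul_pow_mem_perturbed (hf : ∀ i, (f i).totalDegree ≤ d) (i : S) :
    ∑ j, cauchyRows n S (some i) j • xCoord (hatV d f g S σ) j ^ d ∈
      perturbed (Polynomial.X : Polynomial ℂ) (xCoord (hatV d f g S σ)) d := by
  have hlead : (C (2 ^ (d - 1)) * ∑ j : Fin n,
      C (cauchyRows n S (some i) j) * X j ^ d : MvPolynomial (Fin n) ℂ).totalDegree ≤ d :=
    (totalDegree_C_mul_le _ _).trans (totalDegree_finsetSum_le fun j _ =>
      (totalDegree_C_mul_le _ _).trans (isHomogeneous_X_pow j d).totalDegree_le)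
  have htarget : (targetPoly f g σ (some i)).totalDegree ≤ d :=
    (totalDegree_C_mul_le _ _).trans ((totalDegree_toComplex_le _).trans (hf i))
  have hmem := leadingForm_mem_perturbed (x := xCoord (hatV d f g S σ)) (τ := Polynomial.X)
    htarget (totalDegree_fTilde_sub_le i.val) hlead
    (funext fun P => (smul_aeval_xCoord_add_apply _ _ P).trans (constraint_of_mem_hatV P i))
  rw [map_mul, aeval_C, ← Algebra.smul_def] at hmem
  simpa [cauchyRows, ← Algebra.smul_def] using
    mem_of_smul_mem_of_tower (pow_ne_zero (d - 1) two_ne_zero) hmem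

theorem pow_mul_sum_cauchyRows_smul_mem_perturbed_mul (hd : 2 ≤ d)
    (hf : ∀ i, (f i).totalDegree ≤ d) (hg : g.totalDegree ≤ d) (j : Fin n) :
    xCoord (hatV d f g S σ) j ^ (d - 1) * ∑ k, cauchyRows n S k j • multiplier k ∈
      perturbed (Polynomial.X : Polynomial ℂ) (xCoord (hatV d f g S σ)) (d - 1) *
        Submodule.span (Polynomial ℂ)
          (Set.range (multiplier : Option S → hatV d f g S σ → ℂ)) := by
  have hlead (k : Option S) : (C (2 ^ (d - 1) * d * cauchyRows n S k j) *
      X j ^ (d - 1) : MvPolynomial (Fin n) ℂ).totalDegree ≤ d - 1 :=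
    (totalDegree_C_mul_le _ _).trans (isHomogeneous_X_pow j _).totalDegree_le
  have htarget (k : Option S) : (pderiv j (targetPoly f g σ k)).totalDegree ≤ d - 1 :=
    (totalDegree_pderiv_le _ _).trans
      (Nat.sub_le_sub_right (totalDegree_targetPoly_le hf hg k) 1)
  have hinitial (k : Option S) : (pderiv j (initialPoly n d S k) -
      C (2 ^ (d - 1) * d * cauchyRows n S k j) * X j ^ (d - 1)).totalDegree ≤ d - 1 - 1 := by
    rw [pderiv_initialPoly]
    exact totalDegree_C_mul_derivative_T_sub_le (by omega) _ j
  have hmem := sum_leadingForm_mul_mem_perturbed_mul (x := xCoord (hatV d f g S σ))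
    (τ := Polynomial.X) (e := multiplier) htarget hinitial hlead
    (funext fun P => by
      refine (Finset.sum_apply P _ _).trans (Eq.trans ?_ (gradient_of_mem_hatV P j))
      exact Finset.sum_congr rfl fun k _ =>
        congrArg (· * multiplier k P) (smul_aeval_xCoord_add_apply _ _ P))
  have hd₀ : (2 ^ (d - 1) * d : ℂ) ≠ 0 :=
    mul_ne_zero (pow_ne_zero _ two_ne_zero) (Nat.cast_ne_zero.2 (by omega))
  have hsum : ∑ k, aeval (xCoord (hatV d f g S σ)) (C (2 ^ (d - 1) * d * cauchyRows n S k j) *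
      X j ^ (d - 1) : MvPolynomial (Fin n) ℂ) * multiplier k =
      (2 ^ (d - 1) * d : ℂ) • (xCoord (hatV d f g S σ) j ^ (d - 1) *
        ∑ k, cauchyRows n S k j • multiplier k) := by
    simp only [map_mul, map_pow, aeval_C, aeval_X, Algebra.smul_def, Finset.mul_sum]
    exact Finset.sum_congr rfl fun k _ => by ring
  rw [hsum] at hmem
  exact mem_of_smul_mem_of_tower hd₀ hmem

theorem exists_relation_of_mem_hatV (hd : 2 ≤ d) (hf : ∀ i, (f i).totalDegree ≤ d)
    (hg : g.totalDegree ≤ d) (hS : S.card ≤ n) (j : Fin n) :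
    ∃ Φ : Polynomial (Polynomial ℂ), Φ ≠ 0 ∧ ∀ P ∈ hatV d f g S σ,
      (Φ.map (Polynomial.evalRingHom P.t)).eval (P.x j) = 0 := by
  obtain ⟨Φ, hΦ₀, hΦ⟩ := exists_ne_zero_aeval_mul_eq_zero Polynomial.not_isUnit_X
    (totallyNonsingular_cauchyRows n S) hd (by simpa using hS)
    (sum_cauchyRows_smul_pow_mem_perturbed (σ := σ) hf)
    (pow_mul_sum_cauchyRows_smul_mem_perturbed_mul hd hf hg) j
  refine ⟨Φ, hΦ₀, fun P hP => ?_⟩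
  obtain ⟨k, hk⟩ := exists_multiplier_ne_zero ⟨P, hP⟩
  have hPk := (mul_eq_zero.1 (congrFun (hΦ k) ⟨P, hP⟩)).resolve_right hk
  rwa [polynomial_aeval_functionAlgebra_apply] at hPk

end CoordinateRing

section Finiteness

variable {K : Subfield ℝ} {n m d : ℕ} {f : Fin m → MvPolynomial (Fin n) K}
  {g : MvPolynomial (Fin n) K} {S : Finset (Fin m)} {σ : S → ℤˣ}

theorem exists_eq_pow_mul_map_evalRingHom_ne_zero {k : Type*} [Field k]
    {Φ : Polynomial (Polynomial k)} (hΦ : Φ ≠ 0) (c : k) :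
    ∃ (N : ℕ) (Ψ : Polynomial (Polynomial k)),
      Φ = Polynomial.C (Polynomial.X - Polynomial.C c) ^ N * Ψ ∧
        Ψ.map (Polynomial.evalRingHom c) ≠ 0 := by
  have hprime : Prime (Polynomial.C (Polynomial.X - Polynomial.C c)) :=
    Polynomial.prime_C_iff.2 (Polynomial.prime_X_sub_C c)
  obtain ⟨Ψ, hΨ, hndvd⟩ :=
    (FiniteMultiplicity.of_prime_left hprime hΦ).exists_eq_pow_mul_and_not_dvd
  refine ⟨_, Ψ, hΨ, fun h => hndvd ((Polynomial.C_dvd_iff_dvd_coeff _ _).2 fun i => ?_)⟩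
  exact Polynomial.dvd_iff_isRoot.2 (by simpa using congrArg (Polynomial.coeff · i) h)

theorem isClosed_setOf_t_eq {ι : Type} (c : ℂ) : IsClosed {P : TXL n ι | P.t = c} := by
  have heval (P : TXL n ι) : eval P.base (X none - C c) = P.t - c := by simp [TXL.base]
  have h := isClosed_setOf_eval_base_eq_zero (n := n) (ι := ι) (X none - C c)
  simp_rw [heval, sub_eq_zero] at h
  exact h

theorem isClosed_setOf_eval_map_evalRingHom_eq_zero {ι : Type} (Φ : Polynomial (Polynomial ℂ))
    (j : Fin n) :
    IsClosed {P : TXL n ι | (Φ.map (Polynomial.evalRingHom P.t)).eval (P.x j) = 0} := by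
  have heval (P : TXL n ι) : eval P.base (Φ.eval₂
      (Polynomial.aeval (X none : MvPolynomial (Option (Fin n)) ℂ)).toRingHom (X (some j))) =
      (Φ.map (Polynomial.evalRingHom P.t)).eval (P.x j) := by
    rw [Polynomial.hom_eval₂, Polynomial.eval_map, eval_X]
    congr 1
    exact Polynomial.ringHom_ext (fun c => by simp [← algebraMap_eq]) (by simp [TXL.base])
  simpa only [heval] using isClosed_setOf_eval_base_eq_zero (ι := ι) (Φ.eval₂
    (Polynomial.aeval (X none : MvPolynomial (Option (Fin n)) ℂ)).toRingHom (X (some j)))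

theorem eval_map_evalRingHom_eq_zero_of_mem_V {c : ℂ} {N : ℕ} {Ψ : Polynomial (Polynomial ℂ)}
    {j : Fin n} (hΨ : ∀ P ∈ hatV d f g S σ,
      ((Polynomial.C (Polynomial.X - Polynomial.C c) ^ N * Ψ).map
        (Polynomial.evalRingHom P.t)).eval (P.x j) = 0)
    {P : TXL n S} (hP : P ∈ V d f g S σ) (hPt : P.t = c) :
    (Ψ.map (Polynomial.evalRingHom c)).eval (P.x j) = 0 := by
  obtain ⟨Z, ⟨hZ, hZt⟩, hPZ⟩ := hP
  have hZmax : Maximal (fun Z => IsIrreducible Z ∧ Z ⊆ hatV d f g S σ) Z := hZ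
  have hcover : Z ⊆ {P : TXL n S | P.t = c} ∪
      {P : TXL n S | (Ψ.map (Polynomial.evalRingHom P.t)).eval (P.x j) = 0} := fun Q hQ => by
    have h := hΨ Q (hZmax.prop.2 hQ)
    simp only [Polynomial.map_mul, Polynomial.map_pow, Polynomial.map_C, Polynomial.eval_mul,
      Polynomial.eval_pow, Polynomial.eval_C, mul_eq_zero] at h
    exact h.imp (fun h => by simpa [sub_eq_zero] using eq_zero_of_pow_eq_zero h) id
  rcases isPreirreducible_iff_isClosed_union_isClosed.1 hZmax.prop.1.isPreirreducible _ _
    (isClosed_setOf_t_eq c) (isClosed_setOf_eval_map_evalRingHom_eq_zero Ψ j) hcover with h | h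
  · exact absurd ⟨c, h⟩ hZt
  · exact hPt ▸ h hPZ

theorem finite_image_V (hd : 2 ≤ d) (hf : ∀ i, (f i).totalDegree ≤ d)
    (hg : g.totalDegree ≤ d) (hS : S.card ≤ n) (c : ℂ) :
    (TXL.x '' (V d f g S σ ∩ {P | P.t = c})).Finite := by
  choose Φ hΦ₀ hΦ using exists_relation_of_mem_hatV (σ := σ) hd hf hg hS
  choose N Ψ hΨ hΨ₀ using fun j => exists_eq_pow_mul_map_evalRingHom_ne_zero (hΦ₀ j) c
  refine (Set.Finite.pi fun j => Polynomial.finite_setOfPred_isRoot (hΨ₀ j)).subset ?_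
  rintro _ ⟨P, ⟨hP, hPt⟩, rfl⟩ j -
  exact eval_map_evalRingHom_eq_zero_of_mem_V (N := N j) (hΨ j ▸ hΦ j) hP hPt

theorem finite_sampleSet (hd : 2 ≤ d) (hf : ∀ i, (f i).totalDegree ≤ d) (hg : g.totalDegree ≤ d)
    (l : ℕ) : (sampleSet l d f g).Finite :=
  (Set.toFinite _).biUnion fun _ hp => finite_image_V hd hf hg hp.1 1

end Finiteness

/-! ### Compact components of closed sets -/

theorem exists_isClopen_between_connectedComponent {X : Type*} [TopologicalSpace X]
    [CompactSpace X] [T2Space X] {x : X} {U : Set X} (hU : IsOpen U)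
    (hxU : connectedComponent x ⊆ U) :
    ∃ Q : Set X, IsClopen Q ∧ connectedComponent x ⊆ Q ∧ Q ⊆ U := by
  have : Nonempty {s : Set X // IsClopen s ∧ x ∈ s} :=
    ⟨⟨Set.univ, isClopen_univ, Set.mem_univ x⟩⟩
  rw [connectedComponent_eq_iInter_isClopen] at hxU
  obtain ⟨⟨Q, hQ, hxQ⟩, hQU⟩ := exists_subset_nhds_of_isCompact
    (fun Q R => ⟨⟨Q.1 ∩ R.1, Q.2.1.inter R.2.1, Q.2.2, R.2.2⟩, Set.inter_subset_left,
      Set.inter_subset_right⟩)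
    (fun Q => Q.2.1.isClosed.isCompact) fun y hy => hU.mem_nhds (hxU hy)
  exact ⟨Q, hQ, hQ.connectedComponent_subset hxQ, hQU⟩

theorem exists_isCompact_isClosed_diff {X : Type*} [TopologicalSpace X] [T2Space X]
    [LocallyCompactSpace X] {A C U : Set X} (hA : IsClosed A) (hC : IsConnectedComponentOf C A)
    (hCc : IsCompact C) (hU : IsOpen U) (hCU : C ⊆ U) :
    ∃ Q, IsCompact Q ∧ C ⊆ Q ∧ Q ⊆ U ∧ IsClosed (A \ Q) := by
  obtain ⟨x, hx, rfl⟩ := hC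
  obtain ⟨L, hL, hCL, hLU⟩ := exists_compact_between hCc hU hCU
  have hCK : connectedComponentIn A x ⊆ A ∩ L := fun y hy =>
    ⟨connectedComponentIn_subset A x hy, interior_subset (hCL hy)⟩
  have : CompactSpace ↥(A ∩ L) := isCompact_iff_compactSpace.1 (hL.inter_left hA)
  have hxK := hCK (mem_connectedComponentIn hx)
  have hcomp : Subtype.val '' connectedComponent (⟨x, hxK⟩ : ↥(A ∩ L)) =
      connectedComponentIn A x := by
    rw [← connectedComponentIn_eq_image hxK]
    exact (connectedComponentIn_mono x Set.inter_subset_left).antisymm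
      (isPreconnected_connectedComponentIn.subset_connectedComponentIn
        (mem_connectedComponentIn hx) hCK)
  rw [← hcomp] at hCL ⊢
  obtain ⟨Q, hQ, hCQ, hQL⟩ := exists_isClopen_between_connectedComponent
    (isOpen_interior.preimage continuous_subtype_val) (Set.image_subset_iff.1 hCL)
  have hdiff : A \ (Subtype.val '' Q) = Subtype.val '' Qᶜ ∪ A \ interior L := by
    ext y
    constructor
    · rintro ⟨hyA, hyQ⟩
      by_cases hyL : y ∈ interior L
      · exact .inl ⟨⟨y, hyA, interior_subset hyL⟩, fun h => hyQ ⟨_, h, rfl⟩, rfl⟩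
      · exact .inr ⟨hyA, hyL⟩
    · rintro (⟨y, hy, rfl⟩ | ⟨hyA, hyL⟩)
      · exact ⟨y.2.1, fun h => hy (Subtype.val_injective.mem_set_image.1 h)⟩
      · exact ⟨hyA, fun ⟨z, hz, hzy⟩ => hyL (hzy ▸ hQL hz)⟩
  refine ⟨Subtype.val '' Q, hQ.isClosed.isCompact.image continuous_subtype_val,
    Set.image_mono hCQ, ?_, hdiff ▸ ?_⟩
  · rintro _ ⟨y, -, rfl⟩
    exact hLU y.2.2
  · exact (hQ.compl.isClosed.isCompact.image continuous_subtype_val).isClosed.union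
      (hA.inter isOpen_interior.isClosed_compl)

theorem exists_isCompact_inter_subset_interior {X : Type*} [TopologicalSpace X] [T2Space X]
    [LocallyCompactSpace X] {A C U : Set X} (hA : IsClosed A) (hC : IsConnectedComponentOf C A)
    (hCc : IsCompact C) (hU : IsOpen U) (hCU : C ⊆ U) :
    ∃ L, IsCompact L ∧ L ⊆ U ∧ C ⊆ interior L ∧ L ∩ A ⊆ interior L := by
  obtain ⟨Q, hQ, hCQ, hQU, hAQ⟩ := exists_isCompact_isClosed_diff hA hC hCc hU hCU
  obtain ⟨L, hL, hQL, hLU⟩ := exists_compact_between hQ (hU.inter hAQ.isOpen_compl)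
    fun y hy => ⟨hQU hy, fun h => h.2 hy⟩
  refine ⟨L, hL, fun y hy => (hLU hy).1, hCQ.trans hQL, fun y ⟨hyL, hyA⟩ => hQL ?_⟩
  by_contra hyQ
  exact (hLU hyL).2 ⟨hyA, hyQ⟩

/-! ### Lagrange multipliers for polynomials -/

section LagrangeMultipliers

theorem hasStrictFDerivAt_eval {𝕜 ν : Type*} [NontriviallyNormedField 𝕜] [Fintype ν]
    (p : MvPolynomial ν 𝕜) (x : ν → 𝕜) :
    HasStrictFDerivAt (fun y => eval y p)
      (∑ j, eval x (pderiv j p) • ContinuousLinearMap.proj (R := 𝕜) (φ := fun _ : ν => 𝕜) j) x := by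
  classical
  induction p using MvPolynomial.induction_on with
  | C c =>
    simp only [eval_C]
    exact (hasStrictFDerivAt_const c x).congr_fderiv (by ext v; simp)
  | add p r hp hr =>
    simp only [map_add (eval _)]
    exact (hp.add hr).congr_fderiv (by ext v; simp [add_mul, Finset.sum_add_distrib])
  | mul_X p i hp =>
    simp only [map_mul, eval_X]
    refine (hp.mul (hasStrictFDerivAt_apply i x)).congr_fderiv (ContinuousLinearMap.ext fun v => ?_)
    simp [pderiv_X, Pi.single_apply, apply_ite (eval x), add_mul, Finset.sum_add_distrib,
      Finset.mul_sum, mul_assoc, mul_left_comm (x i)]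

theorem exists_subset_not_linearIndependent {k E κ : Type*} [DivisionRing k] [AddCommGroup E]
    [Module k E] [Module.Finite k E] {w : Option κ → E} {S₀ : Finset κ}
    (hw : ¬ LinearIndependent k fun i : Option S₀ => w (i.map (↑))) :
    ∃ S ⊆ S₀, S.card ≤ Module.finrank k E ∧
      ¬ LinearIndependent k fun i : Option S => w (i.map (↑)) := by
  by_cases h : S₀.card ≤ Module.finrank k E
  · exact ⟨S₀, subset_rfl, h, hw⟩
  · obtain ⟨S, hS, hcard⟩ := Finset.exists_subset_card_eq (not_le.1 h).le
    refine ⟨S, hS, hcard.le, fun hli => ?_⟩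
    simpa [hcard] using hli.fintype_card_le_finrank

theorem exists_multipliers_of_isLocalMinOn {ν κ : Type*} [Fintype ν] {p : MvPolynomial ν ℝ}
    {h : κ → MvPolynomial ν ℝ} {S₀ : Finset κ} {x : ν → ℝ}
    (hmin : IsLocalMinOn (fun y => eval y p) {y | ∀ i ∈ S₀, eval y (h i) = eval x (h i)} x) :
    ∃ S ⊆ S₀, S.card ≤ Fintype.card ν ∧ ∃ v : Option S → ℝ, v ≠ 0 ∧
      ∀ j, v none * eval x (pderiv j p) = ∑ i : S, v (some i) * eval x (pderiv j (h i)) := by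
  classical
  let r : Option κ → MvPolynomial ν ℝ := Option.elim' p h
  let grad : Option κ → ν → ℝ := fun k j => eval x (pderiv j (r k))
  have hdep : ¬ LinearIndependent ℝ fun k : Option S₀ => grad (k.map (↑)) := by
    have hextr : IsLocalExtrOn (fun y => eval y p)
        {y | ∀ i : S₀, eval y (h i) = eval x (h i)} x := .inl (by simpa [IsLocalMinOn] using hmin)
    obtain ⟨Λ, Λ₀, hΛ, hsum⟩ := hextr.exists_multipliers_of_hasStrictFDerivAt
      (fun i => hasStrictFDerivAt_eval (h i) x) (hasStrictFDerivAt_eval p x)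
    refine Fintype.not_linearIndependent_iff.2 ⟨Option.elim' Λ₀ Λ, ?_, ?_⟩
    · funext j
      have hj := DFunLike.congr_fun hsum (Pi.single j 1)
      simpa [Fintype.sum_option, grad, r, Pi.single_apply, add_comm] using hj
    · contrapose! hΛ
      exact Prod.ext (funext fun i => hΛ (some i)) (hΛ none)
  obtain ⟨S, hS, hcard, hdep⟩ := exists_subset_not_linearIndependent hdep
  obtain ⟨μ, hμ, k₀, hk₀⟩ := Fintype.not_linearIndependent_iff.1 hdep
  refine ⟨S, hS, by simpa using hcard, Option.elim' (μ none) fun i => -μ (some i), ?_, ?_⟩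
  · intro hv
    refine hk₀ ?_
    have := congrFun hv k₀
    cases k₀ <;> simpa using this
  · intro j
    have hj := congrFun hμ j
    simp only [Fintype.sum_option, Finset.sum_apply, Pi.smul_apply, smul_eq_mul] at hj
    simpa [grad, r, ← add_eq_zero_iff_eq_neg] using hj

end LagrangeMultipliers

/-! ### Minimizers of the deformed problem -/

section RealDeformation

/-- The Chebyshev polynomial `T_d(x_j)` with real coefficients. -/
noncomputable def chebVarReal {n : ℕ} (d : ℕ) (j : Fin n) : MvPolynomial (Fin n) ℝ :=
  Polynomial.aeval (X j) (Polynomial.Chebyshev.T ℝ (d : ℤ))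

/-- The polynomial `g̃` with real coefficients. -/
noncomputable def gTildeReal (n d : ℕ) : MvPolynomial (Fin n) ℝ :=
  ∑ j : Fin n, C ((a n 0 (j.val + 1) : ℚ) : ℝ) * chebVarReal d j

/-- The polynomial `f̃_i` with real coefficients. -/
noncomputable def fTildeReal (n d : ℕ) {m : ℕ} (i : Fin m) : MvPolynomial (Fin n) ℝ :=
  C ((a n (i.val + 1) 0 : ℚ) : ℝ) +
    ∑ j : Fin n, C ((a n (i.val + 1) (j.val + 1) : ℚ) : ℝ) * (chebVarReal d j + 1)

theorem map_chebVarReal {n : ℕ} (d : ℕ) (j : Fin n) :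
    map (algebraMap ℝ ℂ) (chebVarReal d j) = chebVar d j := by
  rw [chebVar, chebVarReal, ← Polynomial.Chebyshev.map_T (algebraMap ℝ ℂ), Polynomial.aeval_def,
    Polynomial.hom_eval₂, Polynomial.aeval_def, Polynomial.eval₂_map, map_X]
  congr 1
  ext c
  simp [algebraMap_eq]

theorem map_gTildeReal (n d : ℕ) : map (algebraMap ℝ ℂ) (gTildeReal n d) = gTilde n d := by
  simp [gTildeReal, gTilde, map_chebVarReal]

theorem map_fTildeReal (n d : ℕ) {m : ℕ} (i : Fin m) :
    map (algebraMap ℝ ℂ) (fTildeReal n d i) = fTilde n d i := by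
  simp [fTildeReal, fTilde, map_chebVarReal]

theorem neg_one_le_eval_T {d : ℕ} (hd : Even d) (y : ℝ) :
    -1 ≤ (Polynomial.Chebyshev.T ℝ (d : ℤ)).eval y := by
  obtain ⟨k, rfl⟩ := hd
  have hT : (Polynomial.Chebyshev.T ℝ ((k + k : ℕ) : ℤ)).eval y =
      2 * (Polynomial.Chebyshev.T ℝ (k : ℤ)).eval y ^ 2 - 1 := by
    rw [← two_mul, Nat.cast_mul, Polynomial.Chebyshev.T_mul]
    simp [Polynomial.Chebyshev.T_two]
  rw [hT]
  linarith [sq_nonneg ((Polynomial.Chebyshev.T ℝ (k : ℤ)).eval y)]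

theorem eval_chebVarReal {n : ℕ} (d : ℕ) (j : Fin n) (x : Fin n → ℝ) :
    eval x (chebVarReal d j) = (Polynomial.Chebyshev.T ℝ (d : ℤ)).eval (x j) := by
  rw [chebVarReal, ← MvPolynomial.coe_aeval_eq_eval, RingHom.coe_coe,
    ← Polynomial.aeval_algHom_apply, aeval_X, Polynomial.coe_aeval_eq_eval]

theorem eval_fTildeReal_pos {n d m : ℕ} (hd : Even d) (i : Fin m) (x : Fin n → ℝ) :
    0 < eval x (fTildeReal n d i) := by
  simp only [fTildeReal, map_add, map_sum, map_mul, eval_C, map_one, eval_chebVarReal]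
  have h₀ : 0 < ((a n (i.val + 1) 0 : ℚ) : ℝ) := Rat.cast_pos.2 (a_pos (Nat.zero_le n) _)
  refine add_pos_of_pos_of_nonneg h₀ (Finset.sum_nonneg fun j _ => mul_nonneg ?_ ?_)
  · exact Rat.cast_nonneg.2 (a_pos (show j.val + 1 ≤ n from j.2) _).le
  · linarith [neg_one_le_eval_T hd (x j)]

variable {K : Subfield ℝ} {n m d l : ℕ} {f : Fin m → MvPolynomial (Fin n) K}
  {g : MvPolynomial (Fin n) K} {t : ℝ} {x : Fin n → ℝ}

/-- The polynomial `G(t, ·)` for a real parameter `t`, with real coefficients. -/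
noncomputable def GReal (d : ℕ) (g : MvPolynomial (Fin n) K) (t : ℝ) : MvPolynomial (Fin n) ℝ :=
  C t * map (algebraMap K ℝ) g + C (1 - t) * gTildeReal n d

/-- The polynomial `F_i^±(t, ·)` for a real parameter `t`, with real coefficients. -/
noncomputable def FReal (d : ℕ) (f : Fin m → MvPolynomial (Fin n) K) (i : Fin m) (ε : ℤˣ)
    (t : ℝ) : MvPolynomial (Fin n) ℝ :=
  C t * map (algebraMap K ℝ) (f i) + C (((ε : ℤ) : ℝ) * (1 - t)) * fTildeReal n d i

theorem map_GReal (g : MvPolynomial (Fin n) K) (t : ℝ) :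
    map (algebraMap ℝ ℂ) (GReal d g t) = G d g t := by
  have h : map (algebraMap ℝ ℂ) (map (algebraMap K ℝ) g) = toComplex g := MvPolynomial.map_map ..
  simp [GReal, G, map_gTildeReal, h]

theorem map_FReal (f : Fin m → MvPolynomial (Fin n) K) (i : Fin m) (ε : ℤˣ) (t : ℝ) :
    map (algebraMap ℝ ℂ) (FReal d f i ε t) = F d f i ε t := by
  have h : map (algebraMap ℝ ℂ) (map (algebraMap K ℝ) (f i)) = toComplex (f i) :=
    MvPolynomial.map_map ..
  simp [FReal, F, map_fTildeReal, h]

theorem eval_map_eq_aeval (x : Fin n → ℝ) (p : MvPolynomial (Fin n) K) :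
    eval x (map (algebraMap K ℝ) p) = aeval x p := by
  rw [eval_map, aeval_def]

theorem eval_GReal (x : Fin n → ℝ) :
    eval x (GReal d g t) = t * aeval x g + (1 - t) * eval x (gTildeReal n d) := by
  simp only [GReal, map_add, map_mul, eval_C, eval_map_eq_aeval]

theorem mul_eval_FReal (i : Fin m) (ε : ℤˣ) (x : Fin n → ℝ) :
    ((ε : ℤ) : ℝ) * eval x (FReal d f i ε t) =
      ((ε : ℤ) : ℝ) * (t * aeval x (f i)) + (1 - t) * eval x (fTildeReal n d i) := by
  simp only [FReal, map_add, map_mul, eval_C, eval_map_eq_aeval]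
  linear_combination (1 - t) * eval x (fTildeReal n d i) * unitsInt_cast_mul_self ℝ ε

/-- The feasible set of the deformed problem at time `t`: an inequality `f_i ≥ 0` becomes
`F_i^+ ≥ 0`, and an equation `f_i = 0` is relaxed to `F_i^- ≤ 0 ≤ F_i^+`. -/
def deformedSet (l d : ℕ) (f : Fin m → MvPolynomial (Fin n) K) (t : ℝ) : Set (Fin n → ℝ) :=
  {x | ∀ (i : Fin m) (ε : ℤˣ), (ε = 1 ∨ i.val < l) →
    0 ≤ ((ε : ℤ) : ℝ) * eval x (FReal d f i ε t)}

theorem eval_FReal_neg_lt_eval_FReal (hd : Even d) (ht : t < 1) (i : Fin m) (x : Fin n → ℝ) :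
    eval x (FReal d f i (-1) t) < eval x (FReal d f i 1 t) := by
  have h := mul_pos (sub_pos.2 ht) (eval_fTildeReal_pos hd i x)
  simp only [FReal, map_add, map_mul, eval_C, Units.val_neg, Units.val_one, Int.cast_neg,
    Int.cast_one]
  linarith

theorem exists_active_sign (hd : Even d) (ht : t < 1) (l : ℕ)
    (f : Fin m → MvPolynomial (Fin n) K) (x : Fin n → ℝ) (i : Fin m) :
    ∃ σ : ℤˣ, (l ≤ i.val → σ = 1) ∧
      ∀ ε : ℤˣ, (ε = 1 ∨ i.val < l) → eval x (FReal d f i ε t) = 0 → ε = σ := by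
  have hlt := eval_FReal_neg_lt_eval_FReal (f := f) hd ht i x
  by_cases h : i.val < l ∧ eval x (FReal d f i (-1) t) = 0
  · refine ⟨-1, fun hi => absurd h.1 hi.not_gt, fun ε _ hε => ?_⟩
    rcases Int.units_eq_one_or ε with rfl | rfl
    · linarith [h.2]
    · rfl
  · refine ⟨1, fun _ => rfl, fun ε hεl hε => ?_⟩
    rcases Int.units_eq_one_or ε with rfl | rfl
    · rfl
    · exact absurd ⟨hεl.resolve_left (by decide), hε⟩ h

theorem eventually_mem_deformedSet {σ : Fin m → ℤˣ} (hx : x ∈ deformedSet l d f t)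
    (hσ : ∀ (i : Fin m) (ε : ℤˣ), (ε = 1 ∨ i.val < l) → eval x (FReal d f i ε t) = 0 → ε = σ i) :
    ∀ᶠ y in 𝓝 x, (∀ i, eval x (FReal d f i (σ i) t) = 0 → eval y (FReal d f i (σ i) t) = 0) →
      y ∈ deformedSet l d f t := by
  have hnhds : ∀ i (ε : ℤˣ), 0 < ((ε : ℤ) : ℝ) * eval x (FReal d f i ε t) →
      ∀ᶠ y in 𝓝 x, 0 < ((ε : ℤ) : ℝ) * eval y (FReal d f i ε t) := fun i ε h =>
    (continuous_const.mul (MvPolynomial.continuous_eval _)).continuousAt.eventually_const_lt h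
  filter_upwards [eventually_all.2 fun i => eventually_all.2 fun ε =>
    eventually_imp_distrib_left.2 (hnhds i ε)] with y hy hactive i ε hε
  rcases (hx i ε hε).eq_or_lt with h | h
  · have hxi : eval x (FReal d f i ε t) = 0 :=
      (mul_eq_zero.1 h.symm).resolve_left (Int.cast_ne_zero.2 ε.ne_zero)
    obtain rfl := hσ i ε hε hxi
    rw [hactive i hxi, mul_zero]
  · exact (hy i ε h).le

theorem eval_ofReal_map (x : Fin n → ℝ) (p : MvPolynomial (Fin n) ℝ) :
    eval (fun j => (x j : ℂ)) (map (algebraMap ℝ ℂ) p) = (eval x p : ℂ) :=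
  (map_eval (algebraMap ℝ ℂ) x p).symm

theorem exists_ofCoords_mem_hatV_of_isMinOn (hd : Even d) (ht : t < 1) {L : Set (Fin n → ℝ)}
    (hxL : x ∈ interior L) (hx : x ∈ deformedSet l d f t)
    (hmin : IsMinOn (fun y => eval y (GReal d g t)) (L ∩ deformedSet l d f t) x) :
    ∃ p ∈ signedSubsets n m l, ∃ v : {v : Option p.1 → ℂ // v ≠ 0},
      TXL.ofCoords ((t : ℂ), (fun j => (x j : ℂ)), v) ∈ hatV d f g p.1 p.2 := by
  classical
  choose σ hσl hσ using exists_active_sign hd ht l f x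
  let S₀ : Finset (Fin m) := {i | eval x (FReal d f i (σ i) t) = 0}
  have hlocal : IsLocalMinOn (fun y => eval y (GReal d g t))
      {y | ∀ i ∈ S₀, eval y (FReal d f i (σ i) t) = eval x (FReal d f i (σ i) t)} x := by
    refine eventually_nhdsWithin_iff.2 ?_
    filter_upwards [eventually_mem_deformedSet hx hσ, mem_interior_iff_mem_nhds.1 hxL]
      with y hy hyL hyS
    exact hmin ⟨hyL, hy fun i hi => (hyS i (by simpa [S₀] using hi)).trans hi⟩
  obtain ⟨S, hS, hcard, v, hv, hgrad⟩ := exists_multipliers_of_isLocalMinOn hlocal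
  have hv' : (fun k => (v k : ℂ)) ≠ 0 := fun h =>
    hv (funext fun k => Complex.ofReal_eq_zero.1 (congrFun h k))
  refine ⟨⟨S, fun i => σ i⟩, ⟨by simpa using hcard, fun i hi => hσl i hi⟩, ⟨_, hv'⟩,
    ofCoords_mem_hatV hv' (fun i => ?_) fun j => ?_⟩
  · have hi : eval x (FReal d f i (σ i) t) = 0 := by simpa [S₀] using hS i.2
    rw [← map_FReal, eval_ofReal_map, hi, Complex.ofReal_zero]
  · simp only [← map_GReal, ← map_FReal, pderiv_map, eval_ofReal_map]
    exact_mod_cast hgrad j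

end RealDeformation

/-! ### The limit `t → 1` -/

section Limit

variable {K : Subfield ℝ} {n m d l : ℕ} {f : Fin m → MvPolynomial (Fin n) K}
  {g : MvPolynomial (Fin n) K}

theorem continuous_aeval_real (p : MvPolynomial (Fin n) K) :
    Continuous fun x : Fin n → ℝ => aeval x p := by
  simpa only [eval_map_eq_aeval] using MvPolynomial.continuous_eval (map (algebraMap K ℝ) p)

theorem mem_feasibleSet_iff {x : Fin n → ℝ} : x ∈ feasibleSet l f ↔
    ∀ (i : Fin m) (ε : ℤˣ), (ε = 1 ∨ i.val < l) → 0 ≤ ((ε : ℤ) : ℝ) * aeval x (f i) := by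
  refine ⟨fun hx i ε hε => ?_, fun hx => ⟨fun i hi => le_antisymm ?_ ?_, fun i _ => ?_⟩⟩
  · rcases lt_or_ge i.val l with hi | hi
    · simp [hx.1 i hi]
    · simpa [hε.resolve_right hi.not_gt] using hx.2 i hi
  · simpa using hx i (-1) (.inr hi)
  · simpa using hx i 1 (.inl rfl)
  · simpa using hx i 1 (.inl rfl)

theorem isClosed_feasibleSet (l : ℕ) (f : Fin m → MvPolynomial (Fin n) K) :
    IsClosed (feasibleSet l f) := by
  have h : feasibleSet l f = ⋂ (i : Fin m) (ε : ℤˣ) (_ : ε = 1 ∨ i.val < l),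
      {x | 0 ≤ ((ε : ℤ) : ℝ) * aeval x (f i)} := by
    ext x
    simp only [mem_feasibleSet_iff, Set.mem_iInter, Set.mem_ofPred_eq]
  rw [h]
  exact isClosed_iInter fun i => isClosed_iInter fun ε => isClosed_iInter fun _ =>
    isClosed_le continuous_const (continuous_const.mul (continuous_aeval_real _))

theorem isClosed_deformedSet (l d : ℕ) (f : Fin m → MvPolynomial (Fin n) K) (t : ℝ) :
    IsClosed (deformedSet l d f t) := by
  have h : deformedSet l d f t = ⋂ (i : Fin m) (ε : ℤˣ) (_ : ε = 1 ∨ i.val < l),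
      {x | 0 ≤ ((ε : ℤ) : ℝ) * eval x (FReal d f i ε t)} := by
    ext x
    simp only [deformedSet, Set.mem_iInter, Set.mem_ofPred_eq]
  rw [h]
  exact isClosed_iInter fun i => isClosed_iInter fun ε => isClosed_iInter fun _ =>
    isClosed_le continuous_const (continuous_const.mul (MvPolynomial.continuous_eval _))

theorem feasibleSet_subset_deformedSet (hd : Even d) {t : ℝ} (ht : t ∈ Set.Icc 0 1) :
    feasibleSet l f ⊆ deformedSet l d f t := fun x hx i ε hε => by
  rw [mul_eval_FReal, mul_left_comm]
  exact add_nonneg (mul_nonneg ht.1 (mem_feasibleSet_iff.1 hx i ε hε))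
    (mul_nonneg (sub_nonneg.2 ht.2) (eval_fTildeReal_pos hd i x).le)

theorem tendsto_deformation {α : Type*} {u : Filter α} {t : α → ℝ} {x : α → Fin n → ℝ}
    {x₀ : Fin n → ℝ} (ht : Tendsto t u (𝓝 1)) (hx : Tendsto x u (𝓝 x₀)) (c : ℝ)
    (p : MvPolynomial (Fin n) K) (p' : MvPolynomial (Fin n) ℝ) :
    Tendsto (fun k => c * (t k * aeval (x k) p) + (1 - t k) * eval (x k) p') u
      (𝓝 (c * aeval x₀ p)) := by
  have hp := ((continuous_aeval_real p).tendsto x₀).comp hx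
  have hp' := ((MvPolynomial.continuous_eval p').tendsto x₀).comp hx
  simpa using ((ht.mul hp).const_mul c).add ((ht.const_sub 1).mul hp')

theorem mem_feasibleSet_of_tendsto {α : Type*} {u : Filter α} [u.NeBot] {t : α → ℝ}
    {x : α → Fin n → ℝ} {x₀ : Fin n → ℝ} (ht : Tendsto t u (𝓝 1)) (hx : Tendsto x u (𝓝 x₀))
    (hmem : ∀ᶠ k in u, x k ∈ deformedSet l d f (t k)) : x₀ ∈ feasibleSet l f := by
  refine mem_feasibleSet_iff.2 fun i ε hε => ge_of_tendsto
    (tendsto_deformation ht hx ((ε : ℤ) : ℝ) (f i) (fTildeReal n d i)) ?_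
  filter_upwards [hmem] with k hk
  rw [← mul_eval_FReal]
  exact hk i ε hε

theorem aeval_le_of_tendsto {α : Type*} {u : Filter α} [u.NeBot] {t : α → ℝ}
    {x : α → Fin n → ℝ} {x₀ c : Fin n → ℝ} (ht : Tendsto t u (𝓝 1)) (hx : Tendsto x u (𝓝 x₀))
    (hle : ∀ᶠ k in u, eval (x k) (GReal d g (t k)) ≤ eval c (GReal d g (t k))) :
    aeval x₀ g ≤ aeval c g := by
  have hG {y : α → Fin n → ℝ} {y₀ : Fin n → ℝ} (hy : Tendsto y u (𝓝 y₀)) :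
      Tendsto (fun k => eval (y k) (GReal d g (t k))) u (𝓝 (aeval y₀ g)) := by
    simpa only [eval_GReal, one_mul] using tendsto_deformation ht hy 1 g (gTildeReal n d)
  exact le_of_tendsto_of_tendsto (hG hx) (hG tendsto_const_nhds) hle

theorem TXL.exists_norm_eq_one_ofCoords_eq {ι : Type} [Fintype ι] (t : ℂ) (x : Fin n → ℂ)
    (v : {v : Option ι → ℂ // v ≠ 0}) :
    ∃ w : {v : Option ι → ℂ // v ≠ 0}, ‖w.1‖ = 1 ∧
      TXL.ofCoords (t, x, w) = TXL.ofCoords (t, x, v) := by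
  have hnorm : (‖v.1‖ : ℂ)⁻¹ ≠ 0 := by simpa using v.2
  refine ⟨⟨(‖v.1‖ : ℂ)⁻¹ • v.1, smul_ne_zero hnorm v.2⟩, ?_, ?_⟩
  · simp [norm_smul, v.2]
  · have h : Projectivization.mk ℂ _ (smul_ne_zero hnorm v.2) = Projectivization.mk ℂ v.1 v.2 :=
      (Projectivization.mk_eq_mk_iff' ℂ _ _ _ _).2 ⟨_, rfl⟩
    simp only [TXL.ofCoords, h]

theorem mem_image_V_of_tendsto {S : Finset (Fin m)} {σ : S → ℤˣ} {α : Type*} {u : Ultrafilter α}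
    {t : α → ℂ} {x : α → Fin n → ℂ} {t₀ : ℂ} {x₀ : Fin n → ℂ} (ht : Tendsto t u (𝓝 t₀))
    (hx : Tendsto x u (𝓝 x₀)) (hne : ∀ᶠ k in (u : Filter α), t k ≠ t₀)
    (hmem : ∀ᶠ k in (u : Filter α), ∃ v : {v : Option S → ℂ // v ≠ 0},
      TXL.ofCoords (t k, x k, v) ∈ hatV d f g S σ) :
    x₀ ∈ TXL.x '' (V d f g S σ ∩ {P | P.t = t₀}) := by
  have hunit : ∀ᶠ k in (u : Filter α), ∃ v : {v : Option S → ℂ // v ≠ 0},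
      v.1 ∈ Metric.sphere 0 1 ∧ TXL.ofCoords (t k, x k, v) ∈ hatV d f g S σ := by
    filter_upwards [hmem] with k ⟨v, hv⟩
    obtain ⟨w, hw, hwv⟩ := TXL.exists_norm_eq_one_ofCoords_eq (t k) (x k) v
    exact ⟨w, mem_sphere_zero_iff_norm.2 hw, hwv ▸ hv⟩
  have : Nonempty {v : Option S → ℂ // v ≠ 0} := let ⟨_, v, _⟩ := hunit.exists; ⟨v⟩
  obtain ⟨v, hv⟩ := hunit.choice
  obtain ⟨v₀, hv₀, hvlim⟩ := (isCompact_sphere (0 : Option S → ℂ) 1).ultrafilter_le_nhds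
    (u.map fun k => (v k).1) (tendsto_principal.2 (hv.mono fun _ hk => hk.1))
  have hv₀ne : v₀ ≠ 0 := ne_zero_of_mem_unit_sphere ⟨v₀, hv₀⟩
  have hlim : Tendsto (fun k => (t k, x k, v k)) u (𝓝 (t₀, x₀, ⟨v₀, hv₀ne⟩)) :=
    ht.prodMk_nhds (hx.prodMk_nhds (tendsto_subtype_rng.2 hvlim))
  exact ⟨_, ⟨ofCoords_mem_V_of_tendsto hlim (hv.mono fun _ hk => hk.2) hne, rfl⟩, rfl⟩

theorem mem_sampleSet_of_tendsto {α : Type*} {u : Ultrafilter α} {t : α → ℂ}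
    {x : α → Fin n → ℂ} {x₀ : Fin n → ℂ} (ht : Tendsto t u (𝓝 1)) (hx : Tendsto x u (𝓝 x₀))
    (hne : ∀ᶠ k in (u : Filter α), t k ≠ 1)
    (hmem : ∀ᶠ k in (u : Filter α), ∃ p ∈ signedSubsets n m l,
      ∃ v : {v : Option p.1 → ℂ // v ≠ 0}, TXL.ofCoords (t k, x k, v) ∈ hatV d f g p.1 p.2) :
    x₀ ∈ sampleSet l d f g := by
  obtain ⟨p, hp, hpmem⟩ : ∃ p ∈ signedSubsets n m l,
      {k | ∃ v : {v : Option p.1 → ℂ // v ≠ 0},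
        TXL.ofCoords (t k, x k, v) ∈ hatV d f g p.1 p.2} ∈ u := by
    refine (Ultrafilter.finite_biUnion_mem_iff (Set.toFinite (signedSubsets n m l))).1 ?_
    filter_upwards [hmem] with k hk
    simpa using hk
  exact Set.mem_biUnion hp (mem_image_V_of_tendsto ht hx hne hpmem)

theorem exists_isMinOn_deformedSet (hd : Even d) {L : Set (Fin n → ℝ)} (hL : IsCompact L)
    {c : Fin n → ℝ} (hcL : c ∈ L) (hc : c ∈ feasibleSet l f) :
    ∃ x : ℝ → Fin n → ℝ, ∀ t ∈ Set.Icc 0 1, x t ∈ L ∩ deformedSet l d f t ∧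
      IsMinOn (fun y => eval y (GReal d g t)) (L ∩ deformedSet l d f t) (x t) := by
  have h (t : ℝ) : ∃ x, t ∈ Set.Icc 0 1 → x ∈ L ∩ deformedSet l d f t ∧
      IsMinOn (fun y => eval y (GReal d g t)) (L ∩ deformedSet l d f t) x := by
    by_cases ht : t ∈ Set.Icc (0 : ℝ) 1
    · obtain ⟨x, hx⟩ := (hL.inter_right (isClosed_deformedSet l d f t)).exists_isMinOn
        ⟨c, hcL, feasibleSet_subset_deformedSet hd ht hc⟩
        (MvPolynomial.continuous_eval (GReal d g t)).continuousOn
      exact ⟨x, fun _ => hx⟩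
    · exact ⟨c, fun h => absurd h ht⟩
  exact ⟨_, fun t => (h t).choose_spec⟩

theorem exists_mem_sampleSet_of_isCompact (hd : Even d) {γ : ℝ}
    (hγ : γ ∈ lowerBounds ((fun x : Fin n → ℝ => aeval x g) '' feasibleSet l f))
    {L : Set (Fin n → ℝ)} (hL : IsCompact L) {c : Fin n → ℝ} (hcL : c ∈ L)
    (hc : c ∈ minimizerSet (feasibleSet l f) g γ)
    (hLint : L ∩ minimizerSet (feasibleSet l f) g γ ⊆ interior L) :
    ∃ z ∈ L, (fun j => (z j : ℂ)) ∈ sampleSet l d f g := by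
  obtain ⟨x, hx⟩ := exists_isMinOn_deformedSet (d := d) (g := g) hd hL hcL hc.1
  let u : Ultrafilter ℝ := Ultrafilter.of (𝓝[<] 1)
  have hu : (u : Filter ℝ) ≤ 𝓝[<] 1 := Ultrafilter.of_le _
  have ht : Tendsto id u (𝓝 (1 : ℝ)) := hu.trans nhdsWithin_le_nhds
  have hIco : ∀ᶠ t in (u : Filter ℝ), t ∈ Set.Ico (0 : ℝ) 1 := hu (Ico_mem_nhdsLT zero_lt_one)
  have hmin := hIco.mono fun t ht => hx t (Set.Ico_subset_Icc_self ht)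
  obtain ⟨x₀, hx₀L, hx₀⟩ := hL.ultrafilter_le_nhds (u.map x)
    (tendsto_principal.2 (hmin.mono fun t h => h.1.1))
  replace hx₀ : Tendsto x u (𝓝 x₀) := hx₀
  have hx₀E : x₀ ∈ feasibleSet l f :=
    mem_feasibleSet_of_tendsto ht hx₀ (hmin.mono fun t h => h.1.2)
  have hx₀c : aeval x₀ g ≤ aeval c g := aeval_le_of_tendsto ht hx₀ <| by
    filter_upwards [hIco, hmin] with t ht h
    exact h.2 ⟨hcL, feasibleSet_subset_deformedSet hd (Set.Ico_subset_Icc_self ht) hc.1⟩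
  have hx₀min : x₀ ∈ minimizerSet (feasibleSet l f) g γ :=
    ⟨hx₀E, (hx₀c.trans_eq hc.2).antisymm (hγ ⟨x₀, hx₀E, rfl⟩)⟩
  refine ⟨x₀, hx₀L, mem_sampleSet_of_tendsto (u := u) (t := fun t => (t : ℂ))
    (x := fun t j => (x t j : ℂ)) ?_ ?_ ?_ ?_⟩
  · exact Complex.ofReal_one ▸ (Complex.continuous_ofReal.tendsto 1).comp ht
  · exact tendsto_pi_nhds.2 fun j =>
      (Complex.continuous_ofReal.tendsto _).comp (tendsto_pi_nhds.1 hx₀ j)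
  · exact hIco.mono fun t ht h => ht.2.ne (Complex.ofReal_eq_one.1 h)
  · filter_upwards [hIco, hmin, hx₀.eventually
      (isOpen_interior.mem_nhds (hLint ⟨hx₀L, hx₀min⟩))] with t ht h hint
    exact exists_ofCoords_mem_hatV_of_isMinOn hd ht.2 hint h.1.2 h.2

theorem exists_mem_sampleSet_of_isOpen (hd : Even d) {γ : ℝ}
    (hγ : γ ∈ lowerBounds ((fun x : Fin n → ℝ => aeval x g) '' feasibleSet l f))
    {C U : Set (Fin n → ℝ)}
    (hC : IsConnectedComponentOf C (minimizerSet (feasibleSet l f) g γ)) (hCc : IsCompact C)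
    (hU : IsOpen U) (hCU : C ⊆ U) :
    ∃ z ∈ U, (fun j => (z j : ℂ)) ∈ sampleSet l d f g := by
  have hclosed : IsClosed (minimizerSet (feasibleSet l f) g γ) :=
    (isClosed_feasibleSet l f).inter (isClosed_eq (continuous_aeval_real g) continuous_const)
  obtain ⟨L, hL, hLU, hCL, hLint⟩ :=
    exists_isCompact_inter_subset_interior hclosed hC hCc hU hCU
  obtain ⟨c, hc, rfl⟩ := hC
  obtain ⟨z, hzL, hz⟩ := exists_mem_sampleSet_of_isCompact hd hγ hL
    (interior_subset (hCL (mem_connectedComponentIn hc))) hc hLint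
  exact ⟨z, hLU hzL, hz⟩

theorem exists_mem_inter_sampleSet (hd : Even d) {γ : ℝ}
    (hγ : γ ∈ lowerBounds ((fun x : Fin n → ℝ => aeval x g) '' feasibleSet l f))
    (hfin : (sampleSet l d f g).Finite) {C : Set (Fin n → ℝ)}
    (hC : IsConnectedComponentOf C (minimizerSet (feasibleSet l f) g γ)) (hCc : IsCompact C) :
    ∃ z ∈ C, (fun j => (z j : ℂ)) ∈ sampleSet l d f g := by
  have hinj : Function.Injective fun (z : Fin n → ℝ) j => (z j : ℂ) :=
    Complex.ofReal_injective.comp_left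
  have hreal := (hfin.preimage hinj.injOn).isClosed
  by_contra! hempty
  obtain ⟨z, hz, hz'⟩ := exists_mem_sampleSet_of_isOpen hd hγ hC hCc hreal.isOpen_compl hempty
  exact hz hz'

theorem minimizerSet_eq_univ_of_totalDegree_eq_zero (hf : ∀ i, (f i).totalDegree = 0)
    (hg : g.totalDegree = 0) {γ : ℝ} (hne : (minimizerSet (feasibleSet l f) g γ).Nonempty) :
    minimizerSet (feasibleSet l f) g γ = Set.univ := by
  have hconst {p : MvPolynomial (Fin n) K} (hp : p.totalDegree = 0) (x y : Fin n → ℝ) :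
      aeval x p = aeval y p := by
    rw [totalDegree_eq_zero_iff_eq_C.1 hp, aeval_C, aeval_C]
  obtain ⟨x, hx, hxγ⟩ := hne
  refine Set.eq_univ_of_forall fun y => ⟨mem_feasibleSet_iff.2 fun i ε hε => ?_, ?_⟩
  · exact hconst (hf i) x y ▸ mem_feasibleSet_iff.1 hx i ε hε
  · exact hconst hg x y ▸ hxγ

theorem pos_of_isCompact_component [NeZero n] (hf : ∀ i, (f i).totalDegree ≤ d)
    (hg : g.totalDegree ≤ d) {γ : ℝ} {C : Set (Fin n → ℝ)}
    (hC : IsConnectedComponentOf C (minimizerSet (feasibleSet l f) g γ)) (hCc : IsCompact C) :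
    0 < d := by
  by_contra hd
  obtain rfl : d = 0 := by omega
  obtain ⟨x, hx, rfl⟩ := hC
  rw [minimizerSet_eq_univ_of_totalDegree_eq_zero (fun i => Nat.le_zero.1 (hf i))
    (Nat.le_zero.1 hg) ⟨x, hx⟩, connectedComponentIn_univ,
    PreconnectedSpace.connectedComponent_eq_univ] at hCc
  exact noncompact_univ _ hCc

end Limit

end PolyMin

theorem mainTheorem4_general (K : Subfield ℝ) (n m l d : ℕ) (hd : Even d) (hd₀ : 0 < d)
    (f : Fin m → MvPolynomial (Fin n) K) (g : MvPolynomial (Fin n) K)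
    (hf : ∀ i, (f i).totalDegree ≤ d) (hg : g.totalDegree ≤ d)
    (gmin : ℝ)
    (hgmin : IsLeast ((fun x : Fin n → ℝ => MvPolynomial.aeval x g) '' PolyMin.feasibleSet l f)
      gmin) :
    (PolyMin.sampleSet l d f g).Finite ∧
      ∀ C : Set (Fin n → ℝ),
        PolyMin.IsConnectedComponentOf C
          (PolyMin.minimizerSet (PolyMin.feasibleSet l f) g gmin) →
        IsCompact C →
        ∃ z ∈ C, (fun j => (z j : ℂ)) ∈ PolyMin.sampleSet l d f g := by
  have hd₂ : 2 ≤ d := Nat.le_of_dvd hd₀ hd.two_dvd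
  have hfin := PolyMin.finite_sampleSet hd₂ hf hg l
  exact ⟨hfin, fun C hC hCc => PolyMin.exists_mem_inter_sampleSet hd hgmin.2 hfin hC hCc⟩

theorem mainTheorem4 (K : Subfield ℝ) (n m l d : ℕ) (hn : 2 ≤ n) (hl : l ≤ m) (hd : Even d)
    (f : Fin m → MvPolynomial (Fin n) K) (g : MvPolynomial (Fin n) K)
    (hf : ∀ i, (f i).totalDegree ≤ d) (hg : g.totalDegree ≤ d)
    (gmin : ℝ)
    (hgmin : IsLeast ((fun x : Fin n → ℝ => MvPolynomial.aeval x g) '' PolyMin.feasibleSet l f)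
      gmin)
    (hcomp : ∃ C : Set (Fin n → ℝ),
      PolyMin.IsConnectedComponentOf C
        (PolyMin.minimizerSet (PolyMin.feasibleSet l f) g gmin) ∧ IsCompact C) :
    (PolyMin.sampleSet l d f g).Finite ∧
      ∀ C : Set (Fin n → ℝ),
        PolyMin.IsConnectedComponentOf C
          (PolyMin.minimizerSet (PolyMin.feasibleSet l f) g gmin) →
        IsCompact C →
        ∃ z ∈ C, (fun j => (z j : ℂ)) ∈ PolyMin.sampleSet l d f g := by
  obtain ⟨C, hC, hCc⟩ := hcomp
  have : NeZero n := ⟨by omega⟩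
  exact mainTheorem4_general K n m l d hd (PolyMin.pos_of_isCompact_component hf hg hC hCc)
    f g hf hg gmin hgmin
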